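/- Let $\mathrm{Vir}$ be the complex Virasoro Lie algebra, with basis $L(k)$ ($k\in\mathbb{Z}$) and $C$, where $C$ is central and $[L(k),L(l)]=(k-l)L(k+l)+\frac{k^3-k}{12}\delta_{k+l,0}\,C$. Let $\mathrm{Vir}_{\ge 0}$ be the subalgebra spanned by $C$ and the $L(k)$ with $k\ge 0$. For $c,h\in\mathbb{C}$ let $\mathcal{V}(2)$ be the $\mathrm{Vir}_{\ge 0}$-module with basis $v,w$ on which $L(k)$ acts by $0$ for $k>0$, $C$ acts by the scalar $c$, and $L(0)v=hv$, $L(0)w=hw+v$. Let $$M_2(c,h)=U(\mathrm{Vir})\otimes_{U(\mathrm{Vir}_{\ge 0})}\mathcal{V}(2)$$ be the corresponding generalized Verma module, and for an integer $n\ge 0$ let $M_2(c,h)(n)=\{u\in M_2(c,h) : (L(0)-n-h)^2u=0\}$ be its subspace of degree $n$. A vector $u$ is called singular if $L(k)u=0$ for all $k>0$. Then for all $c,h\in\mathbb{C}$ and every integer $n\ge 0$, the space of singular vectors in $M_2(c,h)(n)$ has dimension at most $2$. -/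

import Mathlib

open scoped TensorProduct

noncomputable section

attribute [local instance 100] LieRing.ofAssociativeRing

/-- The underlying vector space of the Virasoro algebra: the pair `(f, z)` stands for
`∑ f n • L n + z • C`, where `C` is the central generator. -/
def Virasoro : Type := (ℤ →₀ ℂ) × ℂ

namespace Virasoro

instance : AddCommGroup Virasoro := inferInstanceAs (AddCommGroup ((ℤ →₀ ℂ) × ℂ))

instance : Module ℂ Virasoro := inferInstanceAs (Module ℂ ((ℤ →₀ ℂ) × ℂ))

/-- The identification of the Virasoro algebra with pairs `(f, z)`. -/
def toProd : Virasoro ≃ₗ[ℂ] (ℤ →₀ ℂ) × ℂ := LinearEquiv.refl ℂ ((ℤ →₀ ℂ) × ℂ)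

/-- The coefficients of the `L n`, as a finitely supported function of `n`. -/
def modes : Virasoro →ₗ[ℂ] (ℤ →₀ ℂ) := LinearMap.fst ℂ (ℤ →₀ ℂ) ℂ ∘ₗ toProd.toLinearMap

/-- The coefficient of `L n`, as a linear form. -/
def coeff (n : ℤ) : Virasoro →ₗ[ℂ] ℂ := Finsupp.lapply n ∘ₗ modes

/-- The coefficient of the central generator, as a linear form. -/
def central : Virasoro →ₗ[ℂ] ℂ := LinearMap.snd ℂ (ℤ →₀ ℂ) ℂ ∘ₗ toProd.toLinearMap

/-- The basis element `L(n)`. -/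
def L (n : ℤ) : Virasoro := toProd.symm (Finsupp.single n 1, 0)

/-- The central generator. -/
def C : Virasoro := toProd.symm (0, 1)

@[simp] theorem modes_L (n : ℤ) : modes (L n) = Finsupp.single n 1 := by simp [modes, L]

@[simp] theorem modes_C : modes C = 0 := by simp [modes, C]

@[simp] theorem central_L (n : ℤ) : central (L n) = 0 := by simp [central, L]

@[simp] theorem central_C : central C = 1 := by simp [central, C]

theorem coeff_apply (n : ℤ) (x : Virasoro) : coeff n x = modes x n := rfl

/-- The Virasoro bracket as a bilinear map: on basis elements,
`[L m, L n] = (m - n) L (m + n) + (m ^ 3 - m) / 12 δ_{m + n, 0} C`, and `C` is central. -/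
def bracketMap : Virasoro →ₗ[ℂ] Virasoro →ₗ[ℂ] Virasoro :=
  (Finsupp.lift ((ℤ →₀ ℂ) →ₗ[ℂ] Virasoro) ℂ ℤ fun m =>
    Finsupp.lift Virasoro ℂ ℤ fun n =>
      ((m : ℂ) - (n : ℂ)) • L (m + n) +
        (if m + n = 0 then ((m : ℂ) ^ 3 - (m : ℂ)) / 12 else 0) • C).compl₁₂ modes modes

theorem bracketMap_L_L (m n : ℤ) :
    bracketMap (L m) (L n) = ((m : ℂ) - (n : ℂ)) • L (m + n) +
      (if m + n = 0 then ((m : ℂ) ^ 3 - (m : ℂ)) / 12 else 0) • C := by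
  simp [bracketMap]

theorem bracketMap_C_left (x : Virasoro) : bracketMap C x = 0 := by
  simp [bracketMap]

theorem bracketMap_C_right (x : Virasoro) : bracketMap x C = 0 := by
  simp [bracketMap]

/-- Every element is the combination of the `L n` and `C` given by its coefficients. -/
theorem eq_sum (x : Virasoro) : x = (modes x).sum (fun n a => a • L n) + central x • C := by
  have h1 : ∀ f : ℤ →₀ ℂ, f = f.sum fun n a => a • Finsupp.single n (1 : ℂ) := fun f => by
    simp
  apply toProd.injective
  apply Prod.ext
  · have e (y : Virasoro) : (toProd y).1 = modes y := rfl
    rw [e, e, map_add, map_smul, modes_C, smul_zero, add_zero, Finsupp.sum, map_sum]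
    simp only [map_smul, modes_L]
    exact h1 (modes x)
  · have e (y : Virasoro) : (toProd y).2 = central y := rfl
    rw [e, e, map_add, map_smul, central_C, Finsupp.sum, map_sum]
    simp

/-- The elements `L n` and `C` span. -/
theorem induction_on {p : Virasoro → Prop} (x : Virasoro) (hL : ∀ n, p (L n)) (hC : p C)
    (hadd : ∀ x y, p x → p y → p (x + y)) (hsmul : ∀ (a : ℂ) x, p x → p (a • x)) : p x := by
  have h0 : p 0 := by simpa using hsmul 0 _ hC
  rw [eq_sum x]
  exact hadd _ _ (Finset.sum_induction _ p hadd h0 fun n _ => hsmul _ _ (hL n)) (hsmul _ _ hC)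

theorem bracketMap_skew (x y : Virasoro) : bracketMap x y = -bracketMap y x := by
  induction x using induction_on with
  | hC => simp [bracketMap_C_left, bracketMap_C_right]
  | hadd a b ha hb => simp only [map_add, LinearMap.add_apply, ha, hb]; abel
  | hsmul r a ha => simp only [map_smul, LinearMap.smul_apply, ha, smul_neg]
  | hL m =>
    induction y using induction_on with
    | hC => simp [bracketMap_C_left, bracketMap_C_right]
    | hadd a b ha hb => simp only [map_add, LinearMap.add_apply, ha, hb]; abel
    | hsmul r a ha => simp only [map_smul, LinearMap.smul_apply, ha, smul_neg]
    | hL n =>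
      rw [bracketMap_L_L, bracketMap_L_L, add_comm n m]
      by_cases h : m + n = 0
      · obtain rfl : n = -m := by omega
        simp only [h, if_true]
        push_cast
        module
      · simp only [h, if_false]
        module

theorem bracketMap_jacobi (x y z : Virasoro) :
    bracketMap x (bracketMap y z) =
      bracketMap (bracketMap x y) z + bracketMap y (bracketMap x z) := by
  induction x using induction_on with
  | hC => simp [bracketMap_C_left]
  | hadd a b ha hb => simp only [map_add, LinearMap.add_apply, ha, hb]; abel
  | hsmul r a ha => simp only [map_smul, LinearMap.smul_apply, ha, smul_add]
  | hL l =>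
    induction y using induction_on with
    | hC => simp [bracketMap_C_left, bracketMap_C_right]
    | hadd a b ha hb => simp only [map_add, LinearMap.add_apply, ha, hb]; abel
    | hsmul r a ha => simp only [map_smul, LinearMap.smul_apply, ha, smul_add]
    | hL m =>
      induction z using induction_on with
      | hC => simp [bracketMap_C_right]
      | hadd a b ha hb => simp only [map_add, ha, hb]; abel
      | hsmul r a ha => simp only [map_smul, ha, smul_add]
      | hL n =>
        simp only [bracketMap_L_L, map_add, map_smul, LinearMap.add_apply, LinearMap.smul_apply,
          bracketMap_C_left, bracketMap_C_right, smul_zero, add_zero]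
        rw [show m + (l + n) = l + (m + n) by ring, show l + m + n = l + (m + n) by ring]
        by_cases h : l + (m + n) = 0
        · obtain rfl : n = -l - m := by omega
          simp only [h, if_true]
          push_cast
          module
        · simp only [h, if_false]
          push_cast
          module

instance : LieRing Virasoro where
  bracket x y := bracketMap x y
  add_lie x y z := by simp
  lie_add x y z := by simp
  lie_self x := by
    have h := bracketMap_skew x x
    have h2 : (2 : ℂ) • bracketMap x x = 0 := by
      rw [two_smul]; nth_rewrite 1 [h]; simp
    exact (smul_eq_zero.mp h2).resolve_left two_ne_zero
  leibniz_lie := bracketMap_jacobi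

instance : LieAlgebra ℂ Virasoro where
  lie_smul r x y := by simp [Bracket.bracket]

theorem L_lie_L (m n : ℤ) :
    ⁅L m, L n⁆ = ((m : ℂ) - (n : ℂ)) • L (m + n) +
      (if m + n = 0 then ((m : ℂ) ^ 3 - (m : ℂ)) / 12 else 0) • C :=
  bracketMap_L_L m n

theorem C_lie (x : Virasoro) : ⁅C, x⁆ = 0 := bracketMap_C_left x

theorem lie_eq_sum (x y : Virasoro) :
    ⁅x, y⁆ = (modes x).sum fun m a => (modes y).sum fun n b =>
      (a * b) • (((m : ℂ) - (n : ℂ)) • L (m + n) +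
        (if m + n = 0 then ((m : ℂ) ^ 3 - (m : ℂ)) / 12 else 0) • C) := by
  change bracketMap x y = _
  simp only [bracketMap, LinearMap.compl₁₂_apply, Finsupp.lift_apply, Finsupp.sum,
    LinearMap.sum_apply, LinearMap.smul_apply, Finset.smul_sum, smul_smul]

theorem coeff_lie_eq_zero {x y : Virasoro} {k : ℤ}
    (h : ∀ m n, coeff m x ≠ 0 → coeff n y ≠ 0 → m + n = k → m = n) : coeff k ⁅x, y⁆ = 0 := by
  rw [lie_eq_sum, Finsupp.sum, map_sum]
  refine Finset.sum_eq_zero fun m hm => ?_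
  rw [Finsupp.sum, map_sum]
  refine Finset.sum_eq_zero fun n hn => ?_
  by_cases hk : m + n = k
  · have := h m n (Finsupp.mem_support_iff.1 hm) (Finsupp.mem_support_iff.1 hn) hk
    subst this
    simp [coeff_apply, -ite_smul]
  · simp [coeff_apply, hk, -ite_smul]

theorem central_lie_eq_zero {x y : Virasoro}
    (h : ∀ m n, coeff m x ≠ 0 → coeff n y ≠ 0 → m + n = 0 → m = 0) : central ⁅x, y⁆ = 0 := by
  rw [lie_eq_sum, Finsupp.sum, map_sum]
  refine Finset.sum_eq_zero fun m hm => ?_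
  rw [Finsupp.sum, map_sum]
  refine Finset.sum_eq_zero fun n hn => ?_
  by_cases hk : m + n = 0
  · have := h m n (Finsupp.mem_support_iff.1 hm) (Finsupp.mem_support_iff.1 hn) hk
    subst this
    simp
  · simp [hk]

/-- The subalgebra `Vir_{≥ 0}`, spanned by the `L n` with `n ≥ 0` and by `C`. -/
def nonneg : LieSubalgebra ℂ Virasoro where
  carrier := {x | ∀ n : ℤ, n < 0 → coeff n x = 0}
  add_mem' hx hy n hn := by rw [map_add, hx n hn, hy n hn, add_zero]
  zero_mem' n _ := map_zero _
  smul_mem' r x hx n hn := by rw [map_smul, hx n hn, smul_zero]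
  lie_mem' {x y} hx hy k hk := coeff_lie_eq_zero fun m n hm hn hmn => by
    have h1 : 0 ≤ m := not_lt.1 fun h => hm (hx m h)
    have h2 : 0 ≤ n := not_lt.1 fun h => hn (hy n h)
    omega

theorem coeff_zero_lie_nonneg (x y : nonneg) : coeff 0 ⁅(x : Virasoro), (y : Virasoro)⁆ = 0 :=
  coeff_lie_eq_zero fun m n hm hn hmn => by
    have h1 : 0 ≤ m := not_lt.1 fun h => hm (x.2 m h)
    have h2 : 0 ≤ n := not_lt.1 fun h => hn (y.2 n h)
    omega

theorem central_lie_nonneg (x y : nonneg) : central ⁅(x : Virasoro), (y : Virasoro)⁆ = 0 :=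
  central_lie_eq_zero fun m n hm hn hmn => by
    have h1 : 0 ≤ m := not_lt.1 fun h => hm (x.2 m h)
    have h2 : 0 ≤ n := not_lt.1 fun h => hn (y.2 n h)
    omega

/-- The nilpotent shift on `ℂⁿ`: it kills the first standard basis vector and sends every other
standard basis vector to the preceding one. -/
def shift (n : ℕ) : Module.End ℂ (Fin n → ℂ) where
  toFun f i := if h : (i : ℕ) + 1 < n then f ⟨i + 1, h⟩ else 0
  map_add' f g := by ext i; by_cases h : (i : ℕ) + 1 < n <;> simp [h]
  map_smul' r f := by ext i; by_cases h : (i : ℕ) + 1 < n <;> simp [h]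

/-- The `n`-dimensional representation of `Vir_{≥ 0}` in which `L k` acts as `0` for `k > 0`, `C`
acts as the scalar `c`, and `L 0` acts as a single Jordan block with eigenvalue `h`: in the
standard basis, `L 0 v₁ = h v₁` and `L 0 vᵢ = h vᵢ + vᵢ₋₁` for `i ≥ 2`. -/
def jordanRep (c h : ℂ) (n : ℕ) : nonneg →ₗ⁅ℂ⁆ Module.End ℂ (Fin n → ℂ) where
  toFun x := coeff 0 (x : Virasoro) • (h • (1 : Module.End ℂ (Fin n → ℂ)) + shift n) +
    central (x : Virasoro) • c • (1 : Module.End ℂ (Fin n → ℂ))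
  map_add' x y := by
    have e : ((x + y : nonneg) : Virasoro) = x + y := rfl
    simp only [e, map_add]
    module
  map_smul' r x := by
    have e : ((r • x : nonneg) : Virasoro) = r • (x : Virasoro) := rfl
    simp only [e, map_smul, RingHom.id_apply, smul_eq_mul]
    module
  map_lie' {x y} := by
    simp only [LieSubalgebra.coe_bracket, coeff_zero_lie_nonneg, central_lie_nonneg, zero_smul,
      add_zero]
    rw [LieRing.of_associative_ring_bracket]
    simp only [add_mul, mul_add, smul_mul_assoc, mul_smul_comm, one_mul, mul_one]
    module

end Virasoro

section Induction

variable {𝔤 : Type} [LieRing 𝔤] [LieAlgebra ℂ 𝔤] (𝔟 : LieSubalgebra ℂ 𝔤)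
  {V : Type} [AddCommGroup V] [Module ℂ V] (ρ : 𝔟 →ₗ⁅ℂ⁆ Module.End ℂ V)

/-- The inclusion `U(𝔟) → U(𝔤)`. -/
def envelopingIncl : UniversalEnvelopingAlgebra ℂ 𝔟 →ₐ[ℂ] UniversalEnvelopingAlgebra ℂ 𝔤 :=
  UniversalEnvelopingAlgebra.lift ℂ ((UniversalEnvelopingAlgebra.ι ℂ).comp 𝔟.incl)

/-- The `U(𝔤)`-submodule of `U(𝔤) ⊗ V` (tensor product over `ℂ`) generated by the elements
`u a ⊗ x - u ⊗ a x` with `u ∈ U(𝔤)`, `a ∈ U(𝔟)`, `x ∈ V`. -/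
def balancingRelations :
    Submodule (UniversalEnvelopingAlgebra ℂ 𝔤) (UniversalEnvelopingAlgebra ℂ 𝔤 ⊗[ℂ] V) :=
  Submodule.span (UniversalEnvelopingAlgebra ℂ 𝔤)
    {t | ∃ (u : UniversalEnvelopingAlgebra ℂ 𝔤) (a : UniversalEnvelopingAlgebra ℂ 𝔟) (x : V),
      t = (u * envelopingIncl 𝔟 a) ⊗ₜ[ℂ] x - u ⊗ₜ[ℂ] (UniversalEnvelopingAlgebra.lift ℂ ρ a x)}

/-- The induced module `U(𝔤) ⊗_{U(𝔟)} V`, as a left `U(𝔤)`-module. -/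
abbrev InducedModule : Type := (UniversalEnvelopingAlgebra ℂ 𝔤 ⊗[ℂ] V) ⧸ balancingRelations 𝔟 ρ

end Induction

namespace Virasoro

/-- The generalized Verma module `M_n(c, h)`, induced from the `n`-dimensional Jordan block
representation of `Vir_{≥ 0}`. -/
abbrev GenVerma (c h : ℂ) (n : ℕ) : Type := InducedModule nonneg (jordanRep c h n)

/-- The action of an element of the Virasoro algebra on `M_n(c, h)`. -/
def act (c h : ℂ) (n : ℕ) (x : Virasoro) : Module.End ℂ (GenVerma c h n) :=
  Algebra.lsmul ℂ ℂ (GenVerma c h n) (UniversalEnvelopingAlgebra.ι ℂ x)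

/-- The degree `m` subspace of `M_n(c, h)`, that is `{u : (L(0) - m - h) ^ n u = 0}`. -/
def degreeSpace (c h : ℂ) (n m : ℕ) : Submodule ℂ (GenVerma c h n) :=
  LinearMap.ker ((act c h n (L 0) - ((m : ℂ) + h) • (1 : Module.End ℂ (GenVerma c h n))) ^ n)

/-- A vector is singular if it is annihilated by `Vir_+`, that is by all `L k` with `k > 0`. -/
def IsSingular (c h : ℂ) (n : ℕ) (u : GenVerma c h n) : Prop :=
  ∀ k : ℤ, 0 < k → act c h n (L k) u = 0

/-- The subspace of singular vectors in the degree `m` subspace of `M_n(c, h)`. -/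
def singularSpace (c h : ℂ) (n m : ℕ) : Submodule ℂ (GenVerma c h n) where
  carrier := {u | u ∈ degreeSpace c h n m ∧ IsSingular c h n u}
  add_mem' ha hb := ⟨add_mem ha.1 hb.1, fun k hk => by
    rw [map_add, ha.2 k hk, hb.2 k hk, add_zero]⟩
  zero_mem' := ⟨zero_mem _, fun _ _ => map_zero _⟩
  smul_mem' r _ ha := ⟨Submodule.smul_mem _ r ha.1, fun k hk => by
    rw [map_smul, ha.2 k hk, smul_zero]⟩

end Virasoro

end

/-!
The generalized Verma module is compared with an explicit model in which singular vectors can be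
counted.

The two-dimensional Jordan block is identified with the dual numbers `ℂ[ε]`, with `L 0` acting as
multiplication by `h + ε`. So the generalized Verma module should be an ordinary Verma module of
highest weight `h + ε` with coefficients in `ℂ[ε]`, free on the monomials `L m₁ ⋯ L mᵣ` with
`m₁ ≤ ⋯ ≤ mᵣ < 0`. This is a form of the Poincaré–Birkhoff–Witt theorem, proved by confluence of
straightening: `normalForm` rewrites a word of modes applied to the highest weight vector by removing
descents through the commutation relations and by letting nonnegative final letters act. The result
does not depend on the order of the steps (`exchange`, `normalForm_append_nonneg`); the only
overlap that needs an argument is settled by the Jacobi identity. Hence the free module on normal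
words carries a representation (`vermaRep`), and since straightening is also valid in the induced
module, the induced module embeds into it (`toNormal_injective`).

In the model, the map that sends a vector of degree `n` to its coefficient at `L (-1) ^ n` is
injective on singular vectors (`eq_zero_of_singular`). Suppose that this coefficient vanishes for a
singular vector `f ≠ 0`. Straightening never creates a letter `-1` out of negative letters, so
applying a mode raises the number of letters `-1` of a monomial by at most one. Among the monomials
of `f` with the most letters `-1`, let `-k` be the largest letter other than `-1`. Then
`L (k - 1)` raises the number of letters `-1` of such a monomial only through
`[L (k - 1), L (-k)] = (2 k - 1) L (-1)`, that is by replacing a letter `-k` by `-1`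
(`mode_single_leading`). Distinct monomials that contain `-k` give distinct results, so
`L (k - 1) f ≠ 0`, a contradiction. This argument is valid over `ℂ[ε]`, and the coefficient at
`L (-1) ^ n` lies in `ℂ[ε]`, which has dimension `2` over `ℂ`.
-/

noncomputable section

namespace Virasoro

/-! ### Words and the order that straightening decreases -/

/-- The number of inversions of a word, that is of pairs of positions whose letters are out of
order. -/
def inversions : List ℤ → ℕ
  | [] => 0
  | a :: l => l.countP (· < a) + inversions l

theorem inversions_swap_lt (p q : List ℤ) {x y : ℤ} (hxy : y < x) :
    inversions (p ++ y :: x :: q) < inversions (p ++ x :: y :: q) := by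
  induction p with
  | nil =>
    simp only [List.nil_append, inversions, List.countP_cons]
    have h1 : decide (y < x) = true := by simpa using hxy
    have h2 : decide (x < y) = false := by simpa using hxy.le
    simp only [h1, h2, if_true]
    simp
    omega
  | cons a p ih =>
    simp only [List.cons_append, inversions]
    have : (p ++ y :: x :: q).countP (· < a) = (p ++ x :: y :: q).countP (· < a) :=
      List.Perm.countP_eq _ ((List.Perm.swap _ _ _).append_left p)
    omega

/-- `WordLT w w'` says that `w` is shorter than `w'`, or of equal length with fewer inversions. -/
def WordLT (w w' : List ℤ) : Prop :=
  Prod.Lex (· < ·) (· < ·) (w.length, inversions w) (w'.length, inversions w')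

theorem wordLT_of_length_lt {w w' : List ℤ} (h : w.length < w'.length) : WordLT w w' :=
  Prod.Lex.left _ _ h

theorem wordLT_of_length_eq {w w' : List ℤ} (h : w.length = w'.length)
    (h' : inversions w < inversions w') : WordLT w w' := by
  unfold WordLT
  rw [h]
  exact Prod.Lex.right _ h'

theorem wordLT_swap (p q : List ℤ) {x y : ℤ} (hxy : y < x) :
    WordLT (p ++ y :: x :: q) (p ++ x :: y :: q) :=
  wordLT_of_length_eq (by simp) (inversions_swap_lt p q hxy)

theorem wordLT_trans {u v w : List ℤ} (h : WordLT u v) (h' : WordLT v w) : WordLT u w :=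
  Prod.Lex.trans h h'

theorem word_induction {motive : List ℤ → Prop}
    (step : ∀ w, (∀ w', WordLT w' w → motive w') → motive w) (w : List ℤ) : motive w :=
  (InvImage.wf (fun w : List ℤ => (w.length, inversions w))
    (WellFounded.prod_lex wellFounded_lt wellFounded_lt)).induction w step

/-- Some letter of the word is followed by a smaller one. -/
def HasDescent (w : List ℤ) : Prop :=
  ∃ (p : List ℤ) (x y : ℤ) (q : List ℤ), w = p ++ x :: y :: q ∧ y < x

/-- The last letter of the word is nonnegative. -/
def EndsNonneg (w : List ℤ) : Prop := ∃ (p : List ℤ) (m : ℤ), w = p ++ [m] ∧ 0 ≤ m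

/-! ### The normal form of a word -/

/-- The scalar by which the central term of `[L m, L n]` acts when `C` acts as `c`. -/
def cocycle (c : ℂ) (m n : ℤ) : ℂ := if m + n = 0 then ((m : ℂ) ^ 3 - m) / 12 * c else 0

theorem cocycle_of_ne (c : ℂ) {m n : ℤ} (h : m + n ≠ 0) : cocycle c m n = 0 := if_neg h

theorem cocycle_skew (c : ℂ) (m n : ℤ) : cocycle c n m = -cocycle c m n := by
  unfold cocycle
  by_cases h : m + n = 0
  · obtain rfl : n = -m := by omega
    simp only [add_neg_cancel, neg_add_cancel, if_true]
    push_cast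
    ring
  · rw [if_neg h, if_neg (by omega), neg_zero]

theorem cocycle_self (c : ℂ) (m : ℤ) : cocycle c m m = 0 := by
  have := cocycle_skew c m m
  linear_combination this / 2

theorem cocycle_zero_left (c : ℂ) (m : ℤ) : cocycle c 0 m = 0 := by
  simp [cocycle]

theorem cocycle_jacobi (c : ℂ) (x y z : ℤ) :
    ((x : ℂ) - y) * cocycle c (x + y) z + ((x : ℂ) - z) * cocycle c y (x + z) +
      ((y : ℂ) - z) * cocycle c (y + z) x = 0 := by
  unfold cocycle
  by_cases h : x + y + z = 0
  · obtain rfl : z = -x - y := by omega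
    rw [if_pos (by ring), if_pos (by ring), if_pos (by ring)]
    push_cast
    ring
  · rw [if_neg h, if_neg (by omega), if_neg (by omega)]
    ring

section NormalForm

variable {R : Type*} [CommRing R] [Algebra ℂ R] (c : ℂ) (δ : R)

open Classical in
/-- The expansion of the word `m₁ ⋯ mᵣ`, read as `L m₁ ⋯ L mᵣ` applied to a highest weight vector
of central charge `c` and weight `δ`, in words of weakly increasing negative letters. Some descent
is removed by means of the commutation relations as long as there is one; the rightmost letter is
then absorbed by the highest weight vector as long as it is nonnegative. -/
def normalForm (w : List ℤ) : List ℤ →₀ R :=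
  if H : HasDescent w then
    normalForm (H.choose ++ H.choose_spec.choose_spec.choose :: H.choose_spec.choose ::
      H.choose_spec.choose_spec.choose_spec.choose) +
    ((H.choose_spec.choose : ℂ) - (H.choose_spec.choose_spec.choose : ℂ)) •
      normalForm (H.choose ++ (H.choose_spec.choose + H.choose_spec.choose_spec.choose) ::
        H.choose_spec.choose_spec.choose_spec.choose) +
    cocycle c H.choose_spec.choose H.choose_spec.choose_spec.choose •
      normalForm (H.choose ++ H.choose_spec.choose_spec.choose_spec.choose)
  else if H' : EndsNonneg w then
    if H'.choose_spec.choose = 0 then δ • normalForm H'.choose else 0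
  else Finsupp.single w 1
termination_by (w.length, inversions w)
decreasing_by
  · have h := H.choose_spec.choose_spec.choose_spec.choose_spec
    conv => rhs; rw [h.1]
    exact wordLT_swap _ _ h.2
  · have h := H.choose_spec.choose_spec.choose_spec.choose_spec
    conv => rhs; rw [h.1]
    exact wordLT_of_length_lt (by simp)
  · have h := H.choose_spec.choose_spec.choose_spec.choose_spec
    conv => rhs; rw [h.1]
    exact wordLT_of_length_lt (by simp)
  · have h := H'.choose_spec.choose_spec
    conv => rhs; rw [h.1]
    exact wordLT_of_length_lt (by simp)

/-- The commutation relation for the letters `x`, `y` between the words `p` and `q` is respected by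
normal forms. -/
def Exchange (p : List ℤ) (x y : ℤ) (q : List ℤ) : Prop :=
  normalForm c δ (p ++ x :: y :: q) = normalForm c δ (p ++ y :: x :: q) +
    ((x : ℂ) - y) • normalForm c δ (p ++ (x + y) :: q) +
    cocycle c x y • normalForm c δ (p ++ q)

variable {c δ} in
theorem Exchange.symm {p : List ℤ} {x y : ℤ} {q : List ℤ} (h : Exchange c δ p x y q) :
    Exchange c δ p y x q := by
  unfold Exchange at *
  rw [h, add_comm y x, cocycle_skew c x y]
  module

theorem Exchange.refl (p : List ℤ) (x : ℤ) (q : List ℤ) : Exchange c δ p x x q := by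
  unfold Exchange
  simp [cocycle_self]

variable {c δ} in
theorem exchange_of_descent {p q : List ℤ}
    (h : ∀ x y, y < x → Exchange c δ p x y q) (x y : ℤ) : Exchange c δ p x y q := by
  rcases lt_trichotomy x y with hxy | rfl | hxy
  · exact (h y x hxy).symm
  · exact Exchange.refl c δ p x q
  · exact h x y hxy

/-- Every word with a descent has a descent at which its normal form was defined. -/
theorem exists_exchange {p q : List ℤ} {x y : ℤ} (hxy : y < x) :
    ∃ p' x' y' q', p ++ x :: y :: q = p' ++ x' :: y' :: q' ∧ y' < x' ∧
      Exchange c δ p' x' y' q' := by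
  have H : HasDescent (p ++ x :: y :: q) := ⟨p, x, y, q, rfl, hxy⟩
  have h := H.choose_spec.choose_spec.choose_spec.choose_spec
  refine ⟨_, _, _, _, h.1, h.2, ?_⟩
  unfold Exchange
  rw [← h.1]
  conv_lhs => rw [normalForm, dif_pos H]

theorem normalForm_of_no_descent {w : List ℤ} (h : ¬ HasDescent w) (h' : ¬ EndsNonneg w) :
    normalForm c δ w = Finsupp.single w 1 := by
  rw [normalForm, dif_neg h, dif_neg h']

theorem normalForm_append_of_no_descent {p : List ℤ} {m : ℤ} (hm : 0 ≤ m)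
    (h : ¬ HasDescent (p ++ [m])) :
    normalForm c δ (p ++ [m]) = if m = 0 then δ • normalForm c δ p else 0 := by
  have H' : EndsNonneg (p ++ [m]) := ⟨p, m, rfl, hm⟩
  rw [normalForm, dif_neg h, dif_pos H']
  have h1 := H'.choose_spec.choose_spec.1
  obtain ⟨h2, h3⟩ := List.append_inj' h1 rfl
  rw [List.cons.injEq] at h3
  have h4 := h3.1.symm
  rw [h4, ← h2]

/-! ### Confluence of straightening -/

/-- Of two descents without a common letter, either may be removed first: the relation at one of
them gives the relation at the other. -/
theorem exchange_disjoint {p r q : List ℤ} {x y x' y' : ℤ} (hxy : y < x) (hxy' : y' < x')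
    (ih : ∀ p₁ x₁ y₁ q₁, y₁ < x₁ →
      WordLT (p₁ ++ x₁ :: y₁ :: q₁) (p ++ x :: y :: (r ++ x' :: y' :: q)) →
      Exchange c δ p₁ x₁ y₁ q₁) :
    Exchange c δ p x y (r ++ x' :: y' :: q) ↔
      Exchange c δ (p ++ x :: y :: r) x' y' q := by
  have e1 := ih (p ++ y :: x :: r) x' y' q hxy'
    (by simpa using wordLT_swap p (r ++ x' :: y' :: q) hxy)
  have e2 := ih (p ++ (x + y) :: r) x' y' q hxy' (wordLT_of_length_lt (by simp))
  have e3 := ih (p ++ r) x' y' q hxy' (wordLT_of_length_lt (by simp))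
  have f1 := ih p x y (r ++ y' :: x' :: q) hxy
    (by simpa using wordLT_swap (p ++ x :: y :: r) q hxy')
  have f2 := ih p x y (r ++ (x' + y') :: q) hxy (wordLT_of_length_lt (by simp))
  have f3 := ih p x y (r ++ q) hxy (wordLT_of_length_lt (by simp))
  unfold Exchange at *
  simp only [List.append_assoc, List.cons_append] at *
  rw [e1, e2, e3, f1, f2, f3]
  constructor <;> intro h <;> rw [h] <;> module

/-- Of two descents with a common letter, either may be removed first: the two expansions agree by
the Jacobi identity and the cocycle identity. -/
theorem exchange_overlap {p q : List ℤ} {x y z : ℤ} (hxy : y < x) (hyz : z < y)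
    (ih : ∀ p₁ x₁ y₁ q₁, y₁ < x₁ →
      WordLT (p₁ ++ x₁ :: y₁ :: q₁) (p ++ x :: y :: z :: q) →
      Exchange c δ p₁ x₁ y₁ q₁) :
    Exchange c δ p x y (z :: q) ↔ Exchange c δ (p ++ [x]) y z q := by
  have hlen : ∀ x₁ y₁, Exchange c δ p x₁ y₁ q :=
    exchange_of_descent fun x₁ y₁ h => ih p x₁ y₁ q h (wordLT_of_length_lt (by simp))
  have hxyz : WordLT (p ++ y :: x :: z :: q) (p ++ x :: y :: z :: q) := wordLT_swap _ _ hxy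
  have hxzy : WordLT (p ++ x :: z :: y :: q) (p ++ x :: y :: z :: q) := by
    simpa using wordLT_swap (p ++ [x]) q hyz
  have a1 := ih (p ++ [y]) x z q (hyz.trans hxy) (by simpa using hxyz)
  have a2 := ih p y z (x :: q) hyz
    (wordLT_trans (by simpa using wordLT_swap (p ++ [y]) q (hyz.trans hxy)) hxyz)
  have b1 := ih p x z (y :: q) (hyz.trans hxy) hxzy
  have b2 := ih (p ++ [z]) x y q hxy
    (wordLT_trans (by simpa using wordLT_swap p (y :: q) (hyz.trans hxy)) hxzy)
  have c1 := hlen (x + y) z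
  have c2 := hlen y (x + z)
  have c3 := hlen (y + z) x
  have hJ := cocycle_jacobi c x y z
  unfold Exchange at *
  simp only [List.append_assoc, List.cons_append, List.nil_append] at *
  rw [show y + (x + z) = x + y + z by ring] at c2
  rw [show y + z + x = x + y + z by ring] at c3
  rw [a1, a2, b1, b2, c1, c2, c3]
  push_cast
  have hJ' := congrArg (fun t : ℂ => t • normalForm c δ (p ++ q)) hJ
  simp only [zero_smul] at hJ'
  constructor <;> intro h
  · rw [h]
    linear_combination (norm := module) hJ'
  · rw [h]
    linear_combination (norm := module) -hJ'

/-- Normal forms respect the commutation relations at every position of every word. -/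
theorem exchange (p : List ℤ) (x y : ℤ) (q : List ℤ) : Exchange c δ p x y q := by
  suffices key : ∀ w, ∀ p x y q, w = p ++ x :: y :: q → y < x → Exchange c δ p x y q from
    exchange_of_descent (fun x y h => key _ p x y q rfl h) x y
  intro w
  induction w using word_induction with
  | step w ih =>
  rintro p x y q rfl hxy
  replace ih : ∀ p₁ x₁ y₁ q₁, y₁ < x₁ → WordLT (p₁ ++ x₁ :: y₁ :: q₁) (p ++ x :: y :: q) →
      Exchange c δ p₁ x₁ y₁ q₁ := fun p₁ x₁ y₁ q₁ h h' => ih _ h' _ _ _ _ rfl h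
  obtain ⟨p', x', y', q', he, hxy', hE⟩ := exists_exchange c δ (p := p) (q := q) hxy
  rcases List.append_eq_append_iff.1 he with ⟨r, rfl, h⟩ | ⟨r, rfl, h⟩
  · match r, h with
    | [], h =>
      simp only [List.nil_append, List.cons.injEq] at h
      obtain ⟨rfl, rfl, rfl⟩ := h
      simpa using hE
    | [a], h =>
      simp only [List.cons_append, List.nil_append, List.cons.injEq] at h
      obtain ⟨rfl, rfl, rfl⟩ := h
      exact (exchange_overlap c δ hxy hxy' ih).2 hE
    | a :: b :: r, h =>
      simp only [List.cons_append, List.cons.injEq] at h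
      obtain ⟨rfl, rfl, rfl⟩ := h
      exact (exchange_disjoint c δ hxy hxy' ih).2 hE
  · rw [he] at ih
    match r, h with
    | [], h =>
      simp only [List.nil_append, List.cons.injEq] at h
      obtain ⟨rfl, rfl, rfl⟩ := h
      simpa using hE
    | [a], h =>
      simp only [List.cons_append, List.nil_append, List.cons.injEq] at h
      obtain ⟨rfl, rfl, rfl⟩ := h
      exact (exchange_overlap c δ hxy' hxy ih).1 hE
    | a :: b :: r, h =>
      simp only [List.cons_append, List.cons.injEq] at h
      obtain ⟨rfl, rfl, rfl⟩ := h
      exact (exchange_disjoint c δ hxy' hxy ih).1 hE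

/-- Normal forms respect the action of the nonnegative letters on the highest weight vector. -/
theorem normalForm_append_nonneg (p : List ℤ) {m : ℤ} (hm : 0 ≤ m) :
    normalForm c δ (p ++ [m]) = if m = 0 then δ • normalForm c δ p else 0 := by
  suffices key : ∀ w, ∀ p m, 0 ≤ m → w = p ++ [m] →
      normalForm c δ (p ++ [m]) = if m = 0 then δ • normalForm c δ p else 0 from
    key _ p m hm rfl
  intro w
  induction w using word_induction with
  | step w ih =>
  rintro p m hm rfl
  replace ih : ∀ p₁ m₁, 0 ≤ m₁ → WordLT (p₁ ++ [m₁]) (p ++ [m]) →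
      normalForm c δ (p₁ ++ [m₁]) = if m₁ = 0 then δ • normalForm c δ p₁ else 0 :=
    fun p₁ m₁ h h' => ih _ h' _ _ h rfl
  by_cases H : HasDescent (p ++ [m])
  swap
  · exact normalForm_append_of_no_descent c δ hm H
  obtain ⟨p', x, y, q, he, hxy⟩ := H
  -- The last letter either belongs to the descent or is left alone by the exchange.
  rcases List.eq_nil_or_concat' q with rfl | ⟨q, m', rfl⟩
  · rw [show p' ++ [x, y] = (p' ++ [x]) ++ [y] by simp] at he
    obtain ⟨rfl, h⟩ := List.append_inj' he rfl
    obtain rfl : m = y := by simpa using h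
    have hx : 0 < x := by omega
    have hE := exchange c δ p' x m []
    unfold Exchange at hE
    rw [show p' ++ [m, x] = (p' ++ [m]) ++ [x] by simp,
      ih (p' ++ [m]) x hx.le (by simpa using wordLT_swap p' [] hxy),
      ih p' (x + m) (by omega) (wordLT_of_length_lt (by simp)),
      if_neg hx.ne', if_neg (by omega), cocycle_of_ne c (by omega)] at hE
    rw [List.append_assoc, List.singleton_append, hE, ih p' x hx.le (wordLT_of_length_lt (by simp)),
      if_neg hx.ne']
    simp
  · rw [show p' ++ x :: y :: (q ++ [m']) = (p' ++ x :: y :: q) ++ [m'] by simp] at he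
    obtain ⟨rfl, h⟩ := List.append_inj' he rfl
    obtain rfl : m = m' := by simpa using h
    have hE := exchange c δ p' x y (q ++ [m])
    have hE' := exchange c δ p' x y q
    unfold Exchange at hE hE'
    have e1 := ih (p' ++ y :: x :: q) m hm (by simpa using wordLT_swap p' (q ++ [m]) hxy)
    have e2 := ih (p' ++ (x + y) :: q) m hm (wordLT_of_length_lt (by simp))
    have e3 := ih (p' ++ q) m hm (wordLT_of_length_lt (by simp))
    simp only [List.append_assoc, List.cons_append] at e1 e2 e3 ⊢
    rw [hE, e1, e2, e3, hE']
    split_ifs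
    · module
    · simp

end NormalForm

/-! ### The Verma module on normal words -/

/-- Normal words: weakly increasing words of negative letters. They index the
Poincaré–Birkhoff–Witt monomials `L m₁ ⋯ L mᵣ` with `m₁ ≤ ⋯ ≤ mᵣ < 0`. -/
def IsNormal (w : List ℤ) : Prop := w.Pairwise (· ≤ ·) ∧ ∀ x ∈ w, x < 0

theorem IsNormal.nil : IsNormal [] := ⟨List.Pairwise.nil, by simp⟩

theorem isNormal_cons {a : ℤ} {w : List ℤ} :
    IsNormal (a :: w) ↔ a < 0 ∧ (∀ x ∈ w, a ≤ x) ∧ IsNormal w := by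
  simp only [IsNormal, List.pairwise_cons, List.forall_mem_cons]
  tauto

theorem IsNormal.not_hasDescent {w : List ℤ} (h : IsNormal w) : ¬ HasDescent w := by
  rintro ⟨p, x, y, q, rfl, hxy⟩
  have := (List.pairwise_cons.1 (List.pairwise_append.1 h.1).2.1).1 y (by simp)
  omega

theorem IsNormal.not_endsNonneg {w : List ℤ} (h : IsNormal w) : ¬ EndsNonneg w := by
  rintro ⟨p, m, rfl, hm⟩
  have := h.2 m (by simp)
  omega

theorem pairwise_of_not_hasDescent {w : List ℤ} (h : ¬ HasDescent w) : w.Pairwise (· ≤ ·) := by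
  induction w with
  | nil => exact List.Pairwise.nil
  | cons a w ih =>
    have hw : w.Pairwise (· ≤ ·) := ih fun ⟨p, x, y, q, he, hxy⟩ =>
      h ⟨a :: p, x, y, q, by simp [he], hxy⟩
    match w, hw with
    | [], _ => exact List.pairwise_singleton _ _
    | b :: w, hw =>
      have hab : a ≤ b := not_lt.1 fun hlt => h ⟨[], a, b, w, rfl, hlt⟩
      refine List.pairwise_cons.2 ⟨?_, hw⟩
      rintro x (_ | ⟨_, hx⟩)
      · exact hab
      · exact hab.trans ((List.pairwise_cons.1 hw).1 x hx)

theorem isNormal_of_not {w : List ℤ} (h : ¬ HasDescent w) (h' : ¬ EndsNonneg w) : IsNormal w := by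
  have hs := pairwise_of_not_hasDescent h
  refine ⟨hs, ?_⟩
  rcases List.eq_nil_or_concat' w with rfl | ⟨p, m, rfl⟩
  · simp
  · have hm : m < 0 := not_le.1 fun hm => h' ⟨p, m, rfl, hm⟩
    intro x hx
    rcases List.mem_append.1 hx with hx | hx
    · exact ((List.pairwise_append.1 hs).2.2 x hx m (by simp)).trans_lt hm
    · obtain rfl : x = m := by simpa using hx
      exact hm

/-- The free `R`-module on normal words. -/
abbrev normalSpan (R : Type*) [CommRing R] : Submodule R (List ℤ →₀ R) := Finsupp.supported R R {w | IsNormal w}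

/-- An `R`-linear identity of operators on normal words can be checked on monomials. -/
theorem normalSpan_induction {R : Type*} [CommRing R] {p : (List ℤ →₀ R) → Prop} {f : List ℤ →₀ R}
    (hf : f ∈ normalSpan R) (hs : ∀ w, IsNormal w → p (Finsupp.single w 1)) (h0 : p 0)
    (hadd : ∀ f g, p f → p g → p (f + g)) (hsmul : ∀ (a : R) f, p f → p (a • f)) : p f := by
  rw [normalSpan, Finsupp.supported_eq_span_single] at hf
  induction hf using Submodule.span_induction with
  | mem x hx =>
    obtain ⟨w, hw, rfl⟩ := hx
    exact hs w hw
  | zero => exact h0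
  | add x y _ _ hx hy => exact hadd x y hx hy
  | smul a x _ hx => exact hsmul a x hx

section Verma

variable {R : Type*} [CommRing R] [Algebra ℂ R] (c : ℂ) (δ : R)

theorem normalForm_of_isNormal {w : List ℤ} (h : IsNormal w) :
    normalForm c δ w = Finsupp.single w 1 :=
  normalForm_of_no_descent c δ h.not_hasDescent h.not_endsNonneg

/-- Induction along straightening: a word is normal, or has a descent, or ends in a nonnegative
letter, and the words that replace it in the latter two cases come earlier. -/
theorem word_cases {motive : List ℤ → Prop}
    (normal : ∀ w, IsNormal w → motive w)
    (descent : ∀ p x y q, y < x → motive (p ++ y :: x :: q) → motive (p ++ (x + y) :: q) →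
      motive (p ++ q) → motive (p ++ x :: y :: q))
    (last : ∀ p m, 0 ≤ m → motive p → motive (p ++ [m])) (w : List ℤ) : motive w := by
  induction w using word_induction with
  | step w ih =>
    by_cases h : HasDescent w
    · obtain ⟨p, x, y, q, rfl, hxy⟩ := h
      exact descent p x y q hxy (ih _ (wordLT_swap p q hxy)) (ih _ (wordLT_of_length_lt (by simp)))
        (ih _ (wordLT_of_length_lt (by simp)))
    · by_cases h' : EndsNonneg w
      · obtain ⟨p, m, rfl, hm⟩ := h'
        exact last p m hm (ih _ (wordLT_of_length_lt (by simp)))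
      · exact normal w (isNormal_of_not h h')

theorem smul_mem_normalSpan (a : ℂ) {f : List ℤ →₀ R} (hf : f ∈ normalSpan R) :
    a • f ∈ normalSpan R := by
  rw [← algebraMap_smul R a f]
  exact Submodule.smul_mem _ _ hf

theorem normalForm_mem (w : List ℤ) : normalForm c δ w ∈ normalSpan R := by
  induction w using word_cases with
  | normal w h =>
    rw [normalForm_of_isNormal c δ h]
    exact Finsupp.single_mem_supported R 1 h
  | descent p x y q _ h1 h2 h3 =>
    have := exchange c δ p x y q
    unfold Exchange at this
    rw [this]
    exact add_mem (add_mem h1 (smul_mem_normalSpan _ h2)) (smul_mem_normalSpan _ h3)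
  | last p m hm h =>
    rw [normalForm_append_nonneg c δ p hm]
    split_ifs
    · exact Submodule.smul_mem _ _ h
    · exact Submodule.zero_mem _

/-- The operator by which `L m` acts: a letter `m` is put in front of a word, and the result is
brought to normal form. -/
def mode (m : ℤ) : (List ℤ →₀ R) →ₗ[R] (List ℤ →₀ R) :=
  Finsupp.linearCombination R fun w => normalForm c δ (m :: w)

theorem mode_single (m : ℤ) (w : List ℤ) :
    mode c δ m (Finsupp.single w 1) = normalForm c δ (m :: w) := by
  simp [mode]

theorem mode_mem (m : ℤ) (f : List ℤ →₀ R) : mode c δ m f ∈ normalSpan R := by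
  rw [mode, Finsupp.linearCombination_apply]
  exact Submodule.sum_mem _ fun w _ => Submodule.smul_mem _ _ (normalForm_mem c δ _)

theorem mode_smul (m : ℤ) (a : ℂ) (f : List ℤ →₀ R) :
    mode c δ m (a • f) = a • mode c δ m f :=
  LinearMap.map_smul_of_tower _ a f

theorem mode_normalForm (m : ℤ) (w : List ℤ) :
    mode c δ m (normalForm c δ w) = normalForm c δ (m :: w) := by
  induction w using word_cases with
  | normal w h => rw [normalForm_of_isNormal c δ h, mode_single]
  | descent p x y q _ h1 h2 h3 =>
    have e1 := exchange c δ p x y q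
    have e2 := exchange c δ (m :: p) x y q
    unfold Exchange at e1 e2
    rw [e1, map_add, map_add, mode_smul, mode_smul, h1, h2, h3]
    exact e2.symm
  | last p n hn h =>
    have e := normalForm_append_nonneg c δ (m :: p) hn
    rw [List.cons_append] at e
    rw [normalForm_append_nonneg c δ p hn, e]
    split_ifs
    · rw [map_smul, h]
    · rw [map_zero]

theorem mode_comm (m n : ℤ) {f : List ℤ →₀ R} (hf : f ∈ normalSpan R) :
    mode c δ m (mode c δ n f) = mode c δ n (mode c δ m f) +
      ((m : ℂ) - n) • mode c δ (m + n) f + cocycle c m n • f := by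
  refine normalSpan_induction (p := fun f => mode c δ m (mode c δ n f) =
    mode c δ n (mode c δ m f) + ((m : ℂ) - n) • mode c δ (m + n) f + cocycle c m n • f) hf
    (fun w hw => ?_) ?_ (fun f g hf hg => ?_) (fun a f hf => ?_)
  · simp only [mode_single, mode_normalForm]
    have e := exchange c δ [] m n w
    unfold Exchange at e
    simpa only [List.nil_append, normalForm_of_isNormal c δ hw] using e
  · simp
  · simp only [map_add, hf, hg]
    module
  · simp only [map_smul, hf, smul_add]
    rw [smul_comm a ((m : ℂ) - n), smul_comm a (cocycle c m n)]

theorem mode_single_of_le {m : ℤ} {w : List ℤ} (hw : IsNormal (m :: w)) :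
    mode c δ m (Finsupp.single w 1) = Finsupp.single (m :: w) 1 := by
  rw [mode_single, normalForm_of_isNormal c δ hw]

theorem mode_vacuum {m : ℤ} (hm : 0 < m) : mode c δ m (Finsupp.single [] 1) = 0 := by
  rw [mode_single]
  have := normalForm_append_nonneg c δ [] hm.le
  rwa [if_neg hm.ne', List.nil_append] at this

theorem mode_zero_vacuum : mode c δ 0 (Finsupp.single [] 1) = δ • Finsupp.single [] 1 := by
  rw [mode_single]
  have := normalForm_append_nonneg c δ [] le_rfl
  rwa [if_pos rfl, List.nil_append, normalForm_of_isNormal c δ IsNormal.nil] at this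

theorem mode_zero_single {w : List ℤ} (hw : IsNormal w) :
    mode c δ 0 (Finsupp.single w 1) =
      (δ - algebraMap ℂ R (w.sum : ℤ)) • (Finsupp.single w 1 : List ℤ →₀ R) := by
  induction w with
  | nil => simp [mode_zero_vacuum]
  | cons a w ih =>
    have h := isNormal_cons.1 hw
    have hm := mode_comm c δ 0 a (Finsupp.single_mem_supported R (1 : R) h.2.2)
    rw [ih h.2.2, map_smul, zero_add, cocycle_zero_left, mode_single_of_le c δ hw] at hm
    rw [hm, zero_smul, add_zero, List.sum_cons]
    rw [← algebraMap_smul R ((0 : ℤ) - (a : ℂ)), ← add_smul]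
    congr 1
    simp only [map_sub, map_intCast]
    push_cast
    ring

end Verma

/-! ### Counting the letter `-1` -/

/-- The span of the normal words in which the letter `-1` occurs at most `m` times. -/
abbrev onesLE (R : Type*) [CommRing R] (m : ℕ) : Submodule R (List ℤ →₀ R) :=
  Finsupp.supported R R {w | IsNormal w ∧ w.count (-1) ≤ m}

theorem map_mem_of_supported {R : Type*} [CommRing R] {S : Set (List ℤ)}
    (T : (List ℤ →₀ R) →ₗ[R] (List ℤ →₀ R)) (N : Submodule R (List ℤ →₀ R))
    (h : ∀ w ∈ S, T (Finsupp.single w 1) ∈ N) {f : List ℤ →₀ R}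
    (hf : f ∈ Finsupp.supported R R S) : T f ∈ N := by
  rw [Finsupp.supported_eq_span_single] at hf
  have : Submodule.span R ((fun i => Finsupp.single i (1 : R)) '' S) ≤ N.comap T := by
    rw [Submodule.span_le]
    rintro _ ⟨w, hw, rfl⟩
    exact h w hw
  exact this hf

theorem onesLE_mono {R : Type*} [CommRing R] {m n : ℕ} (h : m ≤ n) : onesLE R m ≤ onesLE R n :=
  Finsupp.supported_mono fun _ hw => ⟨hw.1, hw.2.trans h⟩

theorem single_mem_onesLE {R : Type*} [CommRing R] {w : List ℤ} {m : ℕ} (hw : IsNormal w)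
    (h : w.count (-1) ≤ m) : (Finsupp.single w 1 : List ℤ →₀ R) ∈ onesLE R m :=
  Finsupp.single_mem_supported R 1 ⟨hw, h⟩

/-- A normal word that starts with `-1` has no other letter. -/
theorem IsNormal.eq_replicate {w : List ℤ} (h : IsNormal (-1 :: w)) :
    w = List.replicate w.length (-1) := by
  rw [List.eq_replicate_iff]
  have h' := isNormal_cons.1 h
  refine ⟨rfl, fun b hb => ?_⟩
  have := h'.2.1 b hb
  have := h'.2.2.2 b hb
  omega

theorem isNormal_replicate (m : ℕ) : IsNormal (List.replicate m (-1)) :=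
  ⟨List.pairwise_replicate.2 (Or.inr le_rfl), fun x hx => by
    rw [List.eq_of_mem_replicate hx]; norm_num⟩

theorem IsNormal.sublist_append {v w : List ℤ} (h : IsNormal w) (hv : v.Sublist w) :
    IsNormal (v ++ [-1]) := by
  refine ⟨List.pairwise_append.2 ⟨h.1.sublist hv, List.pairwise_singleton _ _, ?_⟩, ?_⟩
  · intro a ha b hb
    have := h.2 a (hv.subset ha)
    have : b = -1 := by simpa using hb
    omega
  · intro x hx
    rcases List.mem_append.1 hx with hx | hx
    · exact h.2 x (hv.subset hx)
    · have : x = -1 := by simpa using hx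
      omega

section Filtration

variable {R : Type*} [CommRing R] [Algebra ℂ R] (c : ℂ) (δ : R)

theorem smul_mem_onesLE (a : ℂ) {m : ℕ} {f : List ℤ →₀ R} (hf : f ∈ onesLE R m) :
    a • f ∈ onesLE R m := by
  rw [← algebraMap_smul R a f]
  exact Submodule.smul_mem _ _ hf

/-- Straightening a word of negative letters never creates a letter `-1`, since the sum of two
negative letters is at most `-2`. -/
theorem normalForm_mem_onesLE {w : List ℤ} (hw : ∀ x ∈ w, x < 0) :
    normalForm c δ w ∈ onesLE R (w.count (-1)) := by
  induction w using word_cases with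
  | normal w h =>
    rw [normalForm_of_isNormal c δ h]
    exact single_mem_onesLE h le_rfl
  | descent p x y q _ h1 h2 h3 =>
    have hx := hw x (by simp)
    have hy := hw y (by simp)
    have hp : ∀ z ∈ p, z < 0 := fun z hz => hw z (by simp [hz])
    have hq : ∀ z ∈ q, z < 0 := fun z hz => hw z (by simp [hz])
    have hE := exchange c δ p x y q
    unfold Exchange at hE
    rw [hE, cocycle_of_ne c (by omega), zero_smul, add_zero]
    refine add_mem (onesLE_mono (le_of_eq ?_) (h1 ?_)) (smul_mem_onesLE _ (onesLE_mono ?_ (h2 ?_)))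
    · exact ((List.Perm.swap _ _ _).append_left p).count_eq _
    · simp only [List.forall_mem_append, List.forall_mem_cons]
      exact ⟨hp, hy, hx, hq⟩
    · rw [List.count_append, List.count_append, List.count_cons_of_ne (by omega)]
      have := (((List.Sublist.refl q).cons y).cons x).count_le (-1)
      omega
    · simp only [List.forall_mem_append, List.forall_mem_cons]
      exact ⟨hp, by omega, hq⟩
  | last p m hm _ =>
    have := hw m (by simp)
    omega

theorem mode_mem_onesLE {j : ℤ} (hj : j ≤ -2) {m : ℕ} {f : List ℤ →₀ R} (hf : f ∈ onesLE R m) :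
    mode c δ j f ∈ onesLE R m := by
  refine map_mem_of_supported _ _ (fun w hw => ?_) hf
  rw [mode_single]
  refine onesLE_mono ?_ (normalForm_mem_onesLE c δ (w := j :: w) ?_)
  · rw [List.count_cons_of_ne (by omega)]
    exact hw.2
  · exact List.forall_mem_cons.2 ⟨by omega, hw.1.2⟩

theorem mode_neg_one_mem_onesLE {m : ℕ} {f : List ℤ →₀ R} (hf : f ∈ onesLE R m) :
    mode c δ (-1) f ∈ onesLE R (m + 1) := by
  refine map_mem_of_supported _ _ (fun w hw => ?_) hf
  rw [mode_single]
  refine onesLE_mono ?_ (normalForm_mem_onesLE c δ (w := -1 :: w) ?_)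
  · rw [List.count_cons_self]
    exact Nat.succ_le_succ hw.2
  · exact List.forall_mem_cons.2 ⟨by omega, hw.1.2⟩

theorem mode_single_cons (p : ℤ) {a : ℤ} {w : List ℤ} (hw : IsNormal (a :: w)) :
    mode c δ p (Finsupp.single (a :: w) 1) =
      mode c δ a (mode c δ p (Finsupp.single w 1)) +
        ((p : ℂ) - a) • mode c δ (p + a) (Finsupp.single w 1) +
        cocycle c p a • Finsupp.single w 1 := by
  rw [← mode_single_of_le c δ hw]
  exact mode_comm c δ p a (Finsupp.single_mem_supported R 1 (isNormal_cons.1 hw).2.2)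

/-- Any mode raises the number of letters `-1` by at most one. -/
theorem mode_single_mem_onesLE (p : ℤ) {w : List ℤ} (hw : IsNormal w) :
    mode c δ p (Finsupp.single w 1) ∈ onesLE R (w.count (-1) + 1) := by
  induction w generalizing p with
  | nil =>
    rcases lt_trichotomy p 0 with hp | rfl | hp
    · have hn : IsNormal [p] := isNormal_cons.2 ⟨hp, by simp, IsNormal.nil⟩
      rw [mode_single_of_le c δ hn]
      exact single_mem_onesLE hn (List.count_le_length)
    · rw [mode_zero_vacuum]
      exact Submodule.smul_mem _ _ (single_mem_onesLE IsNormal.nil (by simp))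
    · rw [mode_vacuum c δ hp]
      exact zero_mem _
  | cons a w ih =>
    have h := isNormal_cons.1 hw
    rw [mode_single_cons c δ p hw]
    have hle : w.count (-1) ≤ (a :: w).count (-1) := ((List.Sublist.refl w).cons a).count_le _
    refine add_mem (add_mem ?_ (smul_mem_onesLE _ (onesLE_mono (by omega) (ih _ h.2.2))))
      (smul_mem_onesLE _ (single_mem_onesLE h.2.2 (by omega)))
    by_cases ha : a = -1
    · subst ha
      rw [List.count_cons_self]
      exact mode_neg_one_mem_onesLE c δ (ih p h.2.2)
    · rw [List.count_cons_of_ne ha]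
      exact mode_mem_onesLE c δ (by have := h.1; omega) (ih p h.2.2)

/-- Nonnegative modes do not raise the number of letters `-1` in a power of `L (-1)`. -/
theorem mode_replicate_mem_onesLE {p : ℤ} (hp : 0 ≤ p) (m : ℕ) :
    mode c δ p (Finsupp.single (List.replicate m (-1)) 1) ∈ onesLE R m := by
  induction m generalizing p with
  | zero =>
    rcases hp.eq_or_lt with rfl | hp
    · rw [List.replicate_zero, mode_zero_vacuum]
      exact Submodule.smul_mem _ _ (single_mem_onesLE IsNormal.nil (by simp))
    · rw [List.replicate_zero, mode_vacuum c δ hp]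
      exact zero_mem _
  | succ m ih =>
    have hn : IsNormal (-1 :: List.replicate m (-1)) := isNormal_replicate (m + 1)
    have hs : (Finsupp.single (List.replicate m (-1)) 1 : List ℤ →₀ R) ∈ onesLE R m :=
      single_mem_onesLE (isNormal_replicate m) (by simp)
    rw [List.replicate_succ, mode_single_cons c δ p hn]
    refine add_mem (add_mem (mode_neg_one_mem_onesLE c δ (ih hp)) (smul_mem_onesLE _ ?_))
      (smul_mem_onesLE _ (onesLE_mono (by omega) hs))
    rcases hp.eq_or_lt with rfl | hp
    · exact mode_neg_one_mem_onesLE c δ hs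
    · exact onesLE_mono (by omega) (ih (by omega))

/-- Up to words with fewer letters `-1`, the letter `-1` commutes to the end of a normal word. -/
theorem mode_neg_one_single {w : List ℤ} (hw : IsNormal w) :
    mode c δ (-1) (Finsupp.single w 1) - Finsupp.single (w ++ [-1]) 1 ∈
      onesLE R (w.count (-1)) := by
  induction w with
  | nil =>
    rw [mode_single_of_le c δ (show IsNormal [-1] from isNormal_replicate 1)]
    simp
  | cons a w ih =>
    have h := isNormal_cons.1 hw
    by_cases ha : a = -1
    · subst ha
      have hrep : (-1 :: w) ++ [-1] = -1 :: -1 :: w := by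
        rw [hw.eq_replicate, ← List.replicate_succ, ← List.replicate_succ, ← List.replicate_succ']
      have hn : IsNormal (-1 :: -1 :: w) := by
        rw [hw.eq_replicate]
        exact isNormal_replicate (w.length + 2)
      rw [mode_single_of_le c δ hn, hrep, sub_self]
      exact zero_mem _
    · have ha' : a ≤ -2 := by have := h.1; omega
      have hn : IsNormal (a :: (w ++ [-1])) := hw.sublist_append (List.Sublist.refl _)
      rw [mode_single_cons c δ (-1) hw, List.count_cons_of_ne ha, List.cons_append,
        ← mode_single_of_le c δ hn, cocycle_of_ne c (by omega), zero_smul, add_zero,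
        add_sub_right_comm, ← map_sub]
      refine add_mem (mode_mem_onesLE c δ ha' (ih h.2.2)) (smul_mem_onesLE _ ?_)
      exact mode_mem_onesLE c δ (by omega) (single_mem_onesLE h.2.2 le_rfl)

/-- If the letters of `w` other than `-1` are at most `-k`, the only way in which `L (k - 1)` can
raise the number of letters `-1` is by `[L (k - 1), L (-k)] = (2 k - 1) L (-1)`. -/
theorem mode_single_leading {k : ℤ} (hk : 2 ≤ k) {w : List ℤ} (hw : IsNormal w)
    (hwk : ∀ x ∈ w, x = -1 ∨ x ≤ -k) :
    mode c δ (k - 1) (Finsupp.single w 1) -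
      ((2 * (k : ℂ) - 1) * (w.count (-k) : ℕ)) •
        (Finsupp.single (w.erase (-k) ++ [-1]) 1 : List ℤ →₀ R) ∈ onesLE R (w.count (-1)) := by
  induction w with
  | nil =>
    rw [mode_vacuum c δ (by omega)]
    simp
  | cons a w ih =>
    have h := isNormal_cons.1 hw
    by_cases ha : a = -1
    · subst ha
      have hcount : (-1 :: w).count (-k) = 0 := by
        rw [List.count_eq_zero, hw.eq_replicate, ← List.replicate_succ]
        intro hmem
        have := List.eq_of_mem_replicate hmem
        omega
      have hr := mode_replicate_mem_onesLE c δ (p := k - 1) (by omega) (w.length + 1)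
      rw [hcount, Nat.cast_zero, mul_zero, zero_smul, sub_zero]
      rw [hw.eq_replicate, ← List.replicate_succ, List.count_replicate_self]
      exact hr
    have hak : a ≤ -k := (hwk a (by simp)).resolve_left ha
    have ih' := ih h.2.2 fun x hx => hwk x (by simp [hx])
    have ha' : a ≤ -2 := by omega
    have hI := mode_mem_onesLE c δ ha' ih'
    have hs : (Finsupp.single w 1 : List ℤ →₀ R) ∈ onesLE R (w.count (-1)) :=
      single_mem_onesLE h.2.2 le_rfl
    rw [map_sub, mode_smul] at hI
    rw [mode_single_cons c δ (k - 1) hw, List.count_cons_of_ne ha, cocycle_of_ne c (by omega),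
      zero_smul, add_zero]
    by_cases hka : a = -k
    · subst hka
      have h1 := mode_neg_one_single c δ h.2.2
      have hw' : (w.count (-k) : ℂ) • mode c δ (-k) (Finsupp.single (w.erase (-k) ++ [-1]) 1) =
          (w.count (-k) : ℂ) • (Finsupp.single (w ++ [-1]) 1 : List ℤ →₀ R) := by
        by_cases hmem : -k ∈ w
        · match w, hmem with
          | b :: w, hmem =>
            have hb : b = -k := by
              have h2 := h.2.1 b (by simp)
              rcases List.mem_cons.1 hmem with hb | hb
              · exact hb.symm
              · have := (isNormal_cons.1 h.2.2).2.1 _ hb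
                omega
            subst hb
            rw [List.erase_cons_head, mode_single_of_le c δ]
            · rfl
            · exact h.2.2.sublist_append (List.Sublist.refl _)
        · rw [List.count_eq_zero_of_not_mem hmem]
          simp
      rw [mul_smul, hw'] at hI
      rw [List.count_cons_self, List.erase_cons_head, show k - 1 + -k = -1 by ring]
      convert add_mem hI (smul_mem_onesLE (2 * (k : ℂ) - 1) h1) using 1
      push_cast
      module
    · have hn : IsNormal (a :: (w.erase (-k) ++ [-1])) :=
        hw.sublist_append (List.Sublist.cons_cons a List.erase_sublist)
      rw [List.count_cons_of_ne hka, List.erase_cons_tail (by simpa using hka), List.cons_append,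
        ← mode_single_of_le c δ hn]
      convert add_mem hI (smul_mem_onesLE (((k - 1 : ℤ) : ℂ) - a)
        (mode_mem_onesLE c δ (show k - 1 + a ≤ -2 by omega) hs)) using 1
      module

/-- A vector of degree `n` that is annihilated by all positive modes vanishes as soon as its
coefficient at `L (-1) ^ n` does. Among the words of its support with the most letters `-1`, one
picks a word with the largest letter `-k` different from `-1`; then `L (k - 1)` produces a word
with one more letter `-1`, and no other word of the support contributes to it. -/
theorem eq_zero_of_singular {n : ℕ} {f : List ℤ →₀ R} (hf : f ∈ normalSpan R)
    (hdeg : ∀ w ∈ f.support, w.sum = -n) (hsing : ∀ k : ℤ, 0 < k → mode c δ k f = 0)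
    (h1 : f (List.replicate n (-1)) = 0) : f = 0 := by
  by_contra hne
  have hnorm : ∀ w ∈ f.support, IsNormal w := fun w hw => (Finsupp.mem_supported R f).1 hf hw
  obtain ⟨w₀, hw₀, hmax⟩ := f.support.exists_max_image (fun w => w.count (-1))
    (Finsupp.support_nonempty_iff.2 hne)
  set m := w₀.count (-1) with hm
  -- Otherwise all letters of `w₀` are `-1`, so that `w₀` is `L (-1) ^ n`.
  have hex : ∃ k : ℕ, 2 ≤ k ∧ ∃ w ∈ f.support, w.count (-1) = m ∧ -(k : ℤ) ∈ w := by
    by_contra! hno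
    have hall : ∀ x ∈ w₀, x = -1 := fun x hx => by
      by_contra hx1
      have hx0 := (hnorm w₀ hw₀).2 x hx
      refine hno x.natAbs (by omega) w₀ hw₀ rfl ?_
      rwa [show -((x.natAbs : ℕ) : ℤ) = x by omega]
    have hrep : w₀ = List.replicate w₀.length (-1) := List.eq_replicate_iff.2 ⟨rfl, hall⟩
    have hs := hdeg w₀ hw₀
    rw [hrep, List.sum_replicate] at hs
    have hl : w₀.length = n := by
      simp only [smul_neg, nsmul_eq_mul, mul_one, neg_inj] at hs
      exact_mod_cast hs
    rw [hl] at hrep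
    rw [Finsupp.mem_support_iff, hrep] at hw₀
    exact hw₀ h1
  classical
  obtain ⟨hk, w₁, hw₁, hw₁m, hw₁k⟩ := Nat.find_spec hex
  have hmin := fun j => Nat.find_min hex (m := j)
  generalize Nat.find hex = k at hk hw₁k hmin
  have hsmall : ∀ w ∈ f.support, w.count (-1) = m → ∀ x ∈ w, x = -1 ∨ x ≤ -(k : ℤ) := by
    intro w hw hwm x hx
    by_contra! hcon
    have hx0 := (hnorm w hw).2 x hx
    refine hmin x.natAbs (by omega) ⟨by omega, w, hw, hwm, ?_⟩
    rwa [show -((x.natAbs : ℕ) : ℤ) = x by omega]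
  -- The coefficient of `L (k - 1) f` at `v` is a nonzero multiple of the coefficient of `f` at `w₁`.
  set v := w₁.erase (-(k : ℤ)) ++ [-1] with hv
  have hvm : v.count (-1) = m + 1 := by
    rw [hv, List.count_append, List.count_erase_of_ne (by omega), hw₁m]
    simp
  have hvanish : ∀ g ∈ onesLE R m, g v = 0 := fun g hg => by
    by_contra hgv
    have := ((Finsupp.mem_supported R g).1 hg (Finsupp.mem_support_iff.2 hgv)).2
    omega
  have hcoef : ∀ w ∈ f.support, w ≠ w₁ →
      f w • (mode c δ ((k : ℤ) - 1) (Finsupp.single w 1)) v = 0 := by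
    intro w hw hww₁
    have hle : w.count (-1) ≤ m := hmax w hw
    rcases hle.lt_or_eq with hlt | heq
    · rw [hvanish _ (onesLE_mono hlt (mode_single_mem_onesLE c δ _ (hnorm w hw))), smul_zero]
    · have hL := mode_single_leading c δ (k := k) (by omega) (hnorm w hw) (hsmall w hw heq)
      rw [heq] at hL
      have hL' := hvanish _ hL
      rw [Finsupp.sub_apply, sub_eq_zero] at hL'
      rw [hL', Finsupp.smul_apply]
      by_cases hmem : -(k : ℤ) ∈ w
      · rw [Finsupp.single_eq_of_ne, smul_zero, smul_zero]
        intro hvw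
        rw [hv] at hvw
        have hvw' := List.append_cancel_right hvw
        refine hww₁ (List.Perm.eq_of_pairwise (le := (· ≤ ·))
          (fun a b _ _ h h' => le_antisymm h h') (hnorm w hw).1 (hnorm w₁ hw₁).1 ?_)
        refine (List.perm_cons_erase hmem).trans ?_
        rw [← hvw']
        exact (List.perm_cons_erase hw₁k).symm
      · rw [List.count_eq_zero_of_not_mem hmem]
        simp
  have hsum := congrArg (fun g : List ℤ →₀ R => g v) (hsing ((k : ℤ) - 1) (by omega))
  have hexp : mode c δ ((k : ℤ) - 1) f =
      ∑ w ∈ f.support, f w • mode c δ ((k : ℤ) - 1) (Finsupp.single w 1) := by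
    conv_lhs => rw [mode, Finsupp.linearCombination_apply, Finsupp.sum]
    simp only [mode_single]
  simp only [hexp, Finsupp.coe_zero, Pi.zero_apply, Finsupp.finsetSum_apply,
    Finsupp.smul_apply] at hsum
  rw [Finset.sum_eq_single_of_mem w₁ hw₁ hcoef] at hsum
  have hL := hvanish _ (hw₁m ▸ mode_single_leading c δ (k := k) (by omega) (hnorm w₁ hw₁)
    (hsmall w₁ hw₁ hw₁m))
  rw [Finsupp.sub_apply, sub_eq_zero] at hL
  rw [hL, Finsupp.smul_apply, ← hv, Finsupp.single_eq_same, smul_eq_mul, mul_smul_comm, mul_one,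
    smul_eq_zero] at hsum
  refine hsum.elim (fun h0 => ?_) (Finsupp.mem_support_iff.1 hw₁)
  have hc : 0 < w₁.count (-(k : ℤ)) := List.count_pos_iff.2 hw₁k
  rcases mul_eq_zero.1 h0 with h0 | h0
  · have : (2 * (k : ℤ) - 1) = 0 := by exact_mod_cast h0
    omega
  · have : w₁.count (-(k : ℤ)) = 0 := by exact_mod_cast h0
    omega

end Filtration

end Virasoro

section Enveloping

attribute [local instance 100] LieRing.ofAssociativeRing

/-! ### Induction in enveloping algebras -/

/-- An enveloping algebra is generated by the Lie algebra: by the universal property, the identity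
factors through the subalgebra generated by the Lie algebra. -/
theorem universalEnvelopingAlgebra_adjoin_ι {𝔤 : Type*} [LieRing 𝔤] [LieAlgebra ℂ 𝔤] :
    Algebra.adjoin ℂ (Set.range (UniversalEnvelopingAlgebra.ι ℂ (L := 𝔤))) = ⊤ := by
  set S := Algebra.adjoin ℂ (Set.range (UniversalEnvelopingAlgebra.ι ℂ (L := 𝔤)))
  let f : 𝔤 →ₗ⁅ℂ⁆ S :=
    { toFun := fun x => ⟨UniversalEnvelopingAlgebra.ι ℂ x, Algebra.subset_adjoin ⟨x, rfl⟩⟩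
      map_add' := fun x y => Subtype.ext (map_add _ x y)
      map_smul' := fun a x => Subtype.ext (map_smul _ a x)
      map_lie' := fun {x y} => Subtype.ext ((UniversalEnvelopingAlgebra.ι ℂ).map_lie x y) }
  have hf : S.val.comp (UniversalEnvelopingAlgebra.lift ℂ f) = AlgHom.id ℂ _ := by
    apply UniversalEnvelopingAlgebra.hom_ext
    ext x
    change ((UniversalEnvelopingAlgebra.lift ℂ f (UniversalEnvelopingAlgebra.ι ℂ x) : S) :
      UniversalEnvelopingAlgebra ℂ 𝔤) = UniversalEnvelopingAlgebra.ι ℂ x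
    rw [UniversalEnvelopingAlgebra.lift_ι_apply]
    rfl
  refine eq_top_iff.2 fun u _ => ?_
  have := congrArg (fun g => g u) hf
  change ((UniversalEnvelopingAlgebra.lift ℂ f u : S) : UniversalEnvelopingAlgebra ℂ 𝔤) = u at this
  rw [← this]
  exact Subtype.property _

theorem universalEnvelopingAlgebra_induction {𝔤 : Type*} [LieRing 𝔤] [LieAlgebra ℂ 𝔤]
    {p : UniversalEnvelopingAlgebra ℂ 𝔤 → Prop}
    (hι : ∀ x, p (UniversalEnvelopingAlgebra.ι ℂ x)) (hC : ∀ a, p (algebraMap ℂ _ a))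
    (hadd : ∀ u v, p u → p v → p (u + v)) (hmul : ∀ u v, p u → p v → p (u * v))
    (u : UniversalEnvelopingAlgebra ℂ 𝔤) : p u := by
  have hu : u ∈ Algebra.adjoin ℂ (Set.range (UniversalEnvelopingAlgebra.ι ℂ (L := 𝔤))) := by
    rw [universalEnvelopingAlgebra_adjoin_ι]
    trivial
  induction hu using Algebra.adjoin_induction with
  | mem x hx =>
    obtain ⟨y, rfl⟩ := hx
    exact hι y
  | algebraMap a => exact hC a
  | add u v _ _ hu hv => exact hadd u v hu hv
  | mul u v _ _ hu hv => exact hmul u v hu hv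

end Enveloping

namespace Virasoro

/-! ### The representation on normal words -/

/-- The span of the normal words. It is a type of its own so that its additive group is never
looked up through the commutator Lie ring of `R`, which is an instance below. -/
def VermaSpace (R : Type*) [CommRing R] : Type _ := normalSpan R

section Representation

variable {R : Type*} [CommRing R] [Algebra ℂ R] (c : ℂ) (δ : R)

instance : AddCommGroup (VermaSpace R) := inferInstanceAs (AddCommGroup (normalSpan R))

instance : Module ℂ (VermaSpace R) := inferInstanceAs (Module ℂ (normalSpan R))

namespace VermaSpace

/-- A vector of the Verma module, as a combination of words. -/
def incl : VermaSpace R →ₗ[ℂ] (List ℤ →₀ R) := (normalSpan R).subtype.restrictScalars ℂ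

theorem incl_injective : Function.Injective (incl (R := R)) := Subtype.val_injective

theorem incl_mem (f : VermaSpace R) : incl f ∈ normalSpan R := Subtype.property _

end VermaSpace

open VermaSpace

/-- The operator `mode`, restricted to the span of the normal words. -/
def vermaMode (m : ℤ) : Module.End ℂ (VermaSpace R) :=
  ((mode c δ m).restrict (p := normalSpan R) (q := normalSpan R)
    fun f _ => mode_mem c δ m f).restrictScalars ℂ

theorem incl_vermaMode (m : ℤ) (f : VermaSpace R) :
    incl (vermaMode c δ m f) = mode c δ m (incl f) := rfl

theorem vermaMode_comm (m n : ℤ) :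
    vermaMode c δ m * vermaMode c δ n - vermaMode c δ n * vermaMode c δ m =
      ((m : ℂ) - n) • vermaMode c δ (m + n) + cocycle c m n • (1 : Module.End ℂ (VermaSpace R)) := by
  ext1 f
  apply incl_injective
  simp only [LinearMap.sub_apply, LinearMap.add_apply, LinearMap.smul_apply, Module.End.mul_apply,
    Module.End.one_apply, map_sub, map_add, map_smul, incl_vermaMode]
  rw [mode_comm c δ m n (incl_mem f)]
  abel

/-- The linear map underlying `vermaRep`: `L m` acts as `vermaMode c δ m`, and `C` as `c`. -/
def vermaMap : Virasoro →ₗ[ℂ] Module.End ℂ (VermaSpace R) :=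
  Finsupp.lift (Module.End ℂ (VermaSpace R)) ℂ ℤ (vermaMode c δ) ∘ₗ modes +
    central.smulRight (c • (1 : Module.End ℂ (VermaSpace R)))

theorem vermaMap_apply (x : Virasoro) : vermaMap c δ x =
    ((modes x).sum fun m a => a • vermaMode c δ m) +
      central x • c • (1 : Module.End ℂ (VermaSpace R)) := by
  simp [vermaMap]

theorem vermaMap_L (m : ℤ) : vermaMap c δ (L m) = vermaMode c δ m := by
  simp [vermaMap]

theorem vermaMap_C : vermaMap c δ C = c • (1 : Module.End ℂ (VermaSpace R)) := by
  simp [vermaMap]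

theorem vermaMap_lie (x y : Virasoro) : vermaMap c δ ⁅x, y⁆ =
    vermaMap c δ x * vermaMap c δ y - vermaMap c δ y * vermaMap c δ x := by
  induction x using induction_on with
  | hC => simp [C_lie, vermaMap_C]
  | hadd a b ha hb => simp only [add_lie, map_add, ha, hb]; noncomm_ring
  | hsmul r a ha =>
    simp only [smul_lie, map_smul, ha, smul_sub, smul_mul_assoc, mul_smul_comm]
  | hL m =>
    induction y using induction_on with
    | hC => rw [← lie_skew, C_lie]; simp [vermaMap_C]
    | hadd a b ha hb => simp only [lie_add, map_add, ha, hb]; noncomm_ring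
    | hsmul r a ha =>
      simp only [lie_smul, map_smul, ha, smul_sub, smul_mul_assoc, mul_smul_comm]
    | hL n =>
      rw [L_lie_L, map_add, map_smul, map_smul, vermaMap_C]
      simp only [vermaMap_L]
      rw [vermaMode_comm, smul_smul, cocycle]
      simp only [ite_mul, zero_mul]

attribute [local instance 100] LieRing.ofAssociativeRing

/-- The Verma module over `R` of central charge `c` and highest weight `δ`, on the free module
with the Poincaré–Birkhoff–Witt monomials as basis. -/
def vermaRep : Virasoro →ₗ⁅ℂ⁆ Module.End ℂ (VermaSpace R) :=
  { vermaMap c δ with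
    map_lie' := fun {x y} => by
      rw [LieRing.of_associative_ring_bracket]
      exact vermaMap_lie c δ x y }

theorem vermaRep_apply (x : Virasoro) : vermaRep c δ x = vermaMap c δ x := rfl

/-- The copy of `R` spanned by the highest weight vector. -/
def vacuum : R →ₗ[ℂ] VermaSpace R :=
  ((Finsupp.lsingle [] : R →ₗ[R] List ℤ →₀ R).codRestrict (normalSpan R) fun r =>
    Finsupp.single_mem_supported R r IsNormal.nil).restrictScalars ℂ

theorem incl_vacuum (r : R) : incl (vacuum r) = Finsupp.single [] r := rfl

theorem vermaRep_vacuum {x : Virasoro} (hx : x ∈ nonneg) (r : R) :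
    vermaRep c δ x (vacuum r) = vacuum (coeff 0 x • (δ * r) + central x • c • r) := by
  have hr : (Finsupp.single [] r : List ℤ →₀ R) = r • Finsupp.single [] 1 := by simp
  have hpos : ∀ m : ℤ, 0 < m → vermaMode c δ m (vacuum r) = 0 := fun m hm => incl_injective <| by
    rw [incl_vermaMode, incl_vacuum, hr, map_smul, mode_vacuum c δ hm, smul_zero, map_zero]
  have hzero : vermaMode c δ 0 (vacuum r) = vacuum (δ * r) := incl_injective <| by
    rw [incl_vermaMode, incl_vacuum, hr, map_smul, mode_zero_vacuum, incl_vacuum]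
    simp [mul_comm]
  rw [vermaRep_apply, vermaMap_apply, LinearMap.add_apply, Finsupp.sum, LinearMap.sum_apply,
    map_add, map_smul, map_smul, map_smul, ← hzero]
  congr 1
  rw [Finset.sum_eq_single 0]
  · rfl
  · intro m _ hm
    rcases lt_or_gt_of_ne hm with hm | hm
    · have h0 : modes x m = 0 := hx m hm
      rw [h0, zero_smul, LinearMap.zero_apply]
    · rw [LinearMap.smul_apply, hpos m hm, smul_zero]
  · intro h0
    rw [Finsupp.notMem_support_iff.1 h0, zero_smul, LinearMap.zero_apply]

end Representation

/-! ### Comparison with the induced module -/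

section Comparison

attribute [local instance 100] LieRing.ofAssociativeRing

variable (c h : ℂ)

open VermaSpace

/-- The two-dimensional space carrying the Jordan block, as the dual numbers: the generator `w` is
`1`, and `v` is `ε`. -/
def toDual : (Fin 2 → ℂ) ≃ₗ[ℂ] DualNumber ℂ where
  toFun f := TrivSqZeroExt.inl (f 1) + TrivSqZeroExt.inr (f 0)
  invFun r := ![TrivSqZeroExt.snd r, TrivSqZeroExt.fst r]
  map_add' f g := by ext <;> simp
  map_smul' a f := by ext <;> simp
  left_inv f := by ext i; fin_cases i <;> simp
  right_inv r := by ext <;> simp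

/-- The highest weight of the generalized Verma module, as a dual number. -/
def dualWeight : DualNumber ℂ := TrivSqZeroExt.inl h + DualNumber.eps

theorem toDual_jordanRep (x : nonneg) (f : Fin 2 → ℂ) :
    toDual (jordanRep c h 2 x f) = coeff 0 (x : Virasoro) • (dualWeight h * toDual f) +
      central (x : Virasoro) • c • toDual f := by
  have e0 : shift 2 f 0 = f 1 := by simp [shift]
  have e1 : shift 2 f 1 = 0 := by simp [shift]
  ext
  · simp [toDual, dualWeight, jordanRep, e1]
  · simp [toDual, dualWeight, jordanRep, e0]
    ring

/-- The representation on normal words that is compared with the generalized Verma module. -/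
abbrev dualRep : Virasoro →ₗ⁅ℂ⁆ Module.End ℂ (VermaSpace (DualNumber ℂ)) :=
  vermaRep c (dualWeight h)

theorem lift_dualRep_envelopingIncl (a : UniversalEnvelopingAlgebra ℂ nonneg) (f : Fin 2 → ℂ) :
    UniversalEnvelopingAlgebra.lift ℂ (dualRep c h) (envelopingIncl nonneg a)
        (vacuum (toDual f)) =
      vacuum (toDual (UniversalEnvelopingAlgebra.lift ℂ (jordanRep c h 2) a f)) := by
  induction a using universalEnvelopingAlgebra_induction generalizing f with
  | hι x =>
    rw [envelopingIncl, UniversalEnvelopingAlgebra.lift_ι_apply, LieHom.comp_apply,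
      UniversalEnvelopingAlgebra.lift_ι_apply, UniversalEnvelopingAlgebra.lift_ι_apply,
      toDual_jordanRep]
    exact vermaRep_vacuum c (dualWeight h) x.2 (toDual f)
  | hC a => simp
  | hadd u v hu hv => simp only [map_add, LinearMap.add_apply, hu, hv]
  | hmul u v hu hv => simp only [map_mul, Module.End.mul_apply, hu, hv]

/-- The map `u ⊗ x ↦ u x` before passing to the quotient. -/
def preToNormal : (UniversalEnvelopingAlgebra ℂ Virasoro ⊗[ℂ] (Fin 2 → ℂ)) →ₗ[ℂ]
    VermaSpace (DualNumber ℂ) :=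
  TensorProduct.lift
    ((LinearMap.lcomp ℂ _ (vacuum ∘ₗ toDual.toLinearMap)) ∘ₗ
      (UniversalEnvelopingAlgebra.lift ℂ (dualRep c h)).toLinearMap)

theorem preToNormal_tmul (u : UniversalEnvelopingAlgebra ℂ Virasoro) (f : Fin 2 → ℂ) :
    preToNormal c h (u ⊗ₜ f) =
      UniversalEnvelopingAlgebra.lift ℂ (dualRep c h) u (vacuum (toDual f)) := rfl

theorem preToNormal_smul (u : UniversalEnvelopingAlgebra ℂ Virasoro)
    (t : UniversalEnvelopingAlgebra ℂ Virasoro ⊗[ℂ] (Fin 2 → ℂ)) :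
    preToNormal c h (u • t) =
      UniversalEnvelopingAlgebra.lift ℂ (dualRep c h) u (preToNormal c h t) := by
  induction t using TensorProduct.induction_on with
  | zero => simp
  | tmul v f =>
    rw [TensorProduct.smul_tmul', smul_eq_mul, preToNormal_tmul, preToNormal_tmul, map_mul,
      Module.End.mul_apply]
  | add s t hs ht => simp only [smul_add, map_add, hs, ht]

theorem preToNormal_eq_zero
    {t : UniversalEnvelopingAlgebra ℂ Virasoro ⊗[ℂ] (Fin 2 → ℂ)}
    (ht : t ∈ balancingRelations nonneg (jordanRep c h 2)) : preToNormal c h t = 0 := by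
  induction ht using Submodule.span_induction with
  | mem t ht =>
    obtain ⟨u, a, f, rfl⟩ := ht
    rw [map_sub, preToNormal_tmul, preToNormal_tmul, map_mul, Module.End.mul_apply,
      lift_dualRep_envelopingIncl, sub_self]
  | zero => exact map_zero _
  | add s t _ _ hs ht => rw [map_add, hs, ht, add_zero]
  | smul u t _ ht => rw [preToNormal_smul, ht, map_zero]

/-- The map from the generalized Verma module to the module on normal words. -/
def toNormal : GenVerma c h 2 →ₗ[ℂ] VermaSpace (DualNumber ℂ) :=
  ((balancingRelations nonneg (jordanRep c h 2)).restrictScalars ℂ).liftQ (preToNormal c h)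
      (fun _ ht => preToNormal_eq_zero c h ht) ∘ₗ
    (Submodule.Quotient.restrictScalarsEquiv ℂ
      (balancingRelations nonneg (jordanRep c h 2))).symm.toLinearMap

theorem toNormal_mk (t : UniversalEnvelopingAlgebra ℂ Virasoro ⊗[ℂ] (Fin 2 → ℂ)) :
    toNormal c h (Submodule.Quotient.mk t) = preToNormal c h t := rfl

theorem toNormal_act (x : Virasoro) (u : GenVerma c h 2) :
    toNormal c h (act c h 2 x u) = dualRep c h x (toNormal c h u) := by
  induction u using Submodule.Quotient.induction_on with
  | H t =>
    change toNormal c h (Submodule.Quotient.mk (UniversalEnvelopingAlgebra.ι ℂ x • t)) = _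
    rw [toNormal_mk, preToNormal_smul, UniversalEnvelopingAlgebra.lift_ι_apply, toNormal_mk]

theorem act_lie (x y : Virasoro) : act c h 2 ⁅x, y⁆ =
    act c h 2 x * act c h 2 y - act c h 2 y * act c h 2 x := by
  rw [act, LieHom.map_lie, LieRing.of_associative_ring_bracket, map_sub, map_mul, map_mul]
  rfl

theorem act_add (x y : Virasoro) : act c h 2 (x + y) = act c h 2 x + act c h 2 y := by
  simp only [act, map_add]

theorem act_smul (a : ℂ) (x : Virasoro) : act c h 2 (a • x) = a • act c h 2 x := by
  simp only [act, map_smul]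

/-- The image of `1 ⊗ x` in the generalized Verma module. -/
def generator : DualNumber ℂ →ₗ[ℂ] GenVerma c h 2 :=
  (Submodule.Quotient.restrictScalarsEquiv ℂ
      (balancingRelations nonneg (jordanRep c h 2))).toLinearMap ∘ₗ
    ((balancingRelations nonneg (jordanRep c h 2)).restrictScalars ℂ).mkQ ∘ₗ
    TensorProduct.mk ℂ (UniversalEnvelopingAlgebra ℂ Virasoro) (Fin 2 → ℂ) 1 ∘ₗ
    toDual.symm.toLinearMap

theorem generator_toDual (f : Fin 2 → ℂ) : generator c h (toDual f) =
    Submodule.Quotient.mk ((1 : UniversalEnvelopingAlgebra ℂ Virasoro) ⊗ₜ[ℂ] f) := by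
  change Submodule.Quotient.mk ((1 : UniversalEnvelopingAlgebra ℂ Virasoro) ⊗ₜ[ℂ]
    (toDual.symm (toDual f))) = _
  rw [LinearEquiv.symm_apply_apply]
  rfl

theorem act_generator {x : Virasoro} (hx : x ∈ nonneg) (r : DualNumber ℂ) :
    act c h 2 x (generator c h r) =
      generator c h (coeff 0 x • (dualWeight h * r) + central x • c • r) := by
  obtain ⟨f, rfl⟩ := toDual.surjective r
  have e := toDual_jordanRep c h ⟨x, hx⟩ f
  rw [← e, generator_toDual, generator_toDual]
  change Submodule.Quotient.mk (UniversalEnvelopingAlgebra.ι ℂ x •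
    ((1 : UniversalEnvelopingAlgebra ℂ Virasoro) ⊗ₜ[ℂ] f)) = _
  rw [Submodule.Quotient.eq]
  refine Submodule.subset_span ⟨1, UniversalEnvelopingAlgebra.ι ℂ (⟨x, hx⟩ : nonneg), f, ?_⟩
  rw [TensorProduct.smul_tmul', smul_eq_mul, mul_one, one_mul, envelopingIncl,
    UniversalEnvelopingAlgebra.lift_ι_apply, UniversalEnvelopingAlgebra.lift_ι_apply]
  rfl

theorem L_mem_nonneg {m : ℤ} (hm : 0 ≤ m) : L m ∈ nonneg := fun n hn => by
  rw [coeff_apply, modes_L, Finsupp.single_eq_of_ne (by omega)]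

theorem C_mem_nonneg : C ∈ nonneg := fun n _ => by
  rw [coeff_apply, modes_C]
  rfl

/-- The action of the product `L m₁ ⋯ L mᵣ` on the generalized Verma module. -/
def wordAct (w : List ℤ) : Module.End ℂ (GenVerma c h 2) :=
  (w.map fun m => act c h 2 (L m)).prod

theorem wordAct_cons (m : ℤ) (w : List ℤ) :
    wordAct c h (m :: w) = act c h 2 (L m) * wordAct c h w := by
  simp [wordAct]

theorem wordAct_append (p q : List ℤ) :
    wordAct c h (p ++ q) = wordAct c h p * wordAct c h q := by
  simp [wordAct]

theorem act_C_wordAct (w : List ℤ) (r : DualNumber ℂ) :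
    act c h 2 C (wordAct c h w (generator c h r)) = c • wordAct c h w (generator c h r) := by
  induction w with
  | nil =>
    change act c h 2 C (generator c h r) = c • generator c h r
    rw [act_generator c h C_mem_nonneg, coeff_apply]
    simp
  | cons m w ih =>
    have hcomm := act_lie c h C (L m)
    rw [C_lie, act, map_zero, map_zero, eq_comm, sub_eq_zero] at hcomm
    rw [wordAct_cons, Module.End.mul_apply, ← Module.End.mul_apply (act c h 2 C), hcomm,
      Module.End.mul_apply, ih, map_smul]

/-- The map `e_w ↦ L w₁ ⋯ L wᵣ (1 ⊗ x)` from words to the generalized Verma module. -/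
def ofWords : (List ℤ →₀ DualNumber ℂ) →ₗ[ℂ] GenVerma c h 2 :=
  Finsupp.lsum ℂ fun w => wordAct c h w ∘ₗ generator c h

theorem ofWords_single (w : List ℤ) (r : DualNumber ℂ) :
    ofWords c h (Finsupp.single w r) = wordAct c h w (generator c h r) := by
  simp [ofWords]

/-- Straightening is valid in the generalized Verma module. -/
theorem ofWords_normalForm (w : List ℤ) (r : DualNumber ℂ) :
    ofWords c h (r • normalForm c (dualWeight h) w) = wordAct c h w (generator c h r) := by
  induction w using word_cases generalizing r with
  | normal w hw =>
    rw [normalForm_of_isNormal _ _ hw, Finsupp.smul_single, smul_eq_mul, mul_one, ofWords_single]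
  | descent p x y q _ h1 h2 h3 =>
    have hE := exchange c (dualWeight h) p x y q
    unfold Exchange at hE
    have hlie := act_lie c h (L x) (L y)
    rw [L_lie_L, act_add, act_smul, act_smul, eq_sub_iff_add_eq] at hlie
    rw [hE, smul_add, smul_add, smul_comm r ((x : ℂ) - y), smul_comm r (cocycle c x y), map_add,
      map_add, map_smul (ofWords c h) ((x : ℂ) - y), map_smul (ofWords c h) (cocycle c x y), h1, h2,
      h3]
    simp only [wordAct_append, wordAct_cons, Module.End.mul_apply]
    have hz := LinearMap.congr_fun hlie (wordAct c h q (generator c h r))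
    simp only [LinearMap.add_apply, LinearMap.smul_apply, Module.End.mul_apply,
      act_C_wordAct] at hz
    rw [← hz]
    simp only [map_add, map_smul, smul_smul, cocycle]
    split_ifs
    · abel
    · simp only [zero_mul, zero_smul]
      abel
  | last p m hm hp =>
    rw [normalForm_append_nonneg _ _ p hm, wordAct_append, Module.End.mul_apply]
    have e : wordAct c h [m] (generator c h r) = act c h 2 (L m) (generator c h r) := by
      simp [wordAct]
    rw [e, act_generator c h (L_mem_nonneg hm), coeff_apply, modes_L, central_L]
    split_ifs with h0
    · subst h0
      rw [smul_smul, hp]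
      simp [mul_comm]
    · rw [Finsupp.single_eq_of_ne (Ne.symm h0)]
      simp

theorem ofWords_mode (m : ℤ) (f : List ℤ →₀ DualNumber ℂ) :
    ofWords c h (mode c (dualWeight h) m f) = act c h 2 (L m) (ofWords c h f) := by
  induction f using Finsupp.induction_linear with
  | zero => simp
  | add f g hf hg => simp only [map_add, hf, hg]
  | single w r =>
    rw [mode, Finsupp.linearCombination_single, ofWords_normalForm, ofWords_single, wordAct_cons,
      Module.End.mul_apply]

theorem act_C_ofWords (f : List ℤ →₀ DualNumber ℂ) :
    act c h 2 C (ofWords c h f) = c • ofWords c h f := by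
  induction f using Finsupp.induction_linear with
  | zero => simp
  | add f g hf hg => simp only [map_add, hf, hg, smul_add]
  | single w r => rw [ofWords_single, act_C_wordAct]

theorem ofWords_dualRep (x : Virasoro) (f : VermaSpace (DualNumber ℂ)) :
    ofWords c h (incl (dualRep c h x f)) =
      act c h 2 x (ofWords c h (incl f)) := by
  induction x using induction_on with
  | hL n =>
    rw [vermaRep_apply, vermaMap_L]
    exact ofWords_mode c h n (incl f)
  | hC =>
    rw [vermaRep_apply, vermaMap_C, act_C_ofWords]
    exact map_smul (ofWords c h) c (incl f)
  | hadd x y hx hy =>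
    rw [map_add, act_add, LinearMap.add_apply, LinearMap.add_apply, map_add, map_add, hx,
      hy]
  | hsmul a x hx =>
    rw [map_smul, act_smul, LinearMap.smul_apply, LinearMap.smul_apply, ← hx]
    exact map_smul (ofWords c h) a _

theorem ofWords_lift (u : UniversalEnvelopingAlgebra ℂ Virasoro)
    (f : VermaSpace (DualNumber ℂ)) :
    ofWords c h (incl (UniversalEnvelopingAlgebra.lift ℂ (dualRep c h) u f)) = u • ofWords c h (incl f) := by
  induction u using universalEnvelopingAlgebra_induction generalizing f with
  | hι x =>
    rw [UniversalEnvelopingAlgebra.lift_ι_apply]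
    exact ofWords_dualRep c h x f
  | hC a =>
    rw [AlgHom.commutes, algebraMap_smul]
    exact map_smul (ofWords c h) a (incl f)
  | hadd u v hu hv =>
    rw [map_add, LinearMap.add_apply, map_add, map_add, hu, hv, add_smul]
  | hmul u v hu hv => rw [map_mul, Module.End.mul_apply, hu, hv, mul_smul]

/-- The generalized Verma module has no relations beyond those of the module on normal words. -/
theorem ofWords_toNormal (u : GenVerma c h 2) :
    ofWords c h (incl (toNormal c h u)) = u := by
  induction u using Submodule.Quotient.induction_on with
  | H t =>
    rw [toNormal_mk]
    induction t using TensorProduct.induction_on with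
    | zero => simp
    | tmul u f =>
      rw [preToNormal_tmul, ofWords_lift, incl_vacuum, ofWords_single]
      change u • generator c h (toDual f) = _
      rw [generator_toDual, ← Submodule.Quotient.mk_smul, TensorProduct.smul_tmul', smul_eq_mul,
        mul_one]
    | add s t hs ht =>
      rw [map_add, map_add, map_add, hs, ht, Submodule.Quotient.mk_add]

theorem toNormal_injective : Function.Injective (toNormal c h) :=
  Function.LeftInverse.injective
    (g := fun f : VermaSpace (DualNumber ℂ) => ofWords c h (incl f))
    (ofWords_toNormal c h)

end Comparison

/-! ### Singular vectors -/

theorem mode_zero_apply {R : Type*} [CommRing R] [Algebra ℂ R] (c : ℂ) (δ : R)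
    {f : List ℤ →₀ R} (hf : f ∈ normalSpan R) (w : List ℤ) :
    mode c δ 0 f w = (δ - algebraMap ℂ R (w.sum : ℤ)) * f w := by
  refine normalSpan_induction (p := fun f => mode c δ 0 f w =
    (δ - algebraMap ℂ R (w.sum : ℤ)) * f w) hf (fun v hv => ?_) (by simp)
    (fun f g hf hg => ?_) (fun a f hf => ?_)
  · rw [mode_zero_single c δ hv, Finsupp.smul_apply, smul_eq_mul]
    by_cases hvw : v = w
    · rw [hvw]
    · rw [Finsupp.single_eq_of_ne (Ne.symm hvw), mul_zero, mul_zero]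
  · rw [map_add, Finsupp.add_apply, Finsupp.add_apply, hf, hg, mul_add]
  · rw [map_smul, Finsupp.smul_apply, Finsupp.smul_apply, hf, smul_eq_mul, smul_eq_mul,
      mul_left_comm]

section

variable (c h : ℂ)

open VermaSpace

theorem incl_toNormal_act_L (m : ℤ) (u : GenVerma c h 2) :
    incl (toNormal c h (act c h 2 (L m) u)) =
      mode c (dualWeight h) m (incl (toNormal c h u)) := by
  rw [toNormal_act, vermaRep_apply, vermaMap_L, incl_vermaMode]

theorem incl_toNormal_shifted (m : ℕ) (u : GenVerma c h 2) (w : List ℤ) :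
    incl (toNormal c h ((act c h 2 (L 0) -
      ((m : ℂ) + h) • (1 : Module.End ℂ (GenVerma c h 2))) u)) w =
    (DualNumber.eps - algebraMap ℂ (DualNumber ℂ) ((w.sum + m : ℤ) : ℂ)) *
      incl (toNormal c h u) w := by
  rw [LinearMap.sub_apply, LinearMap.smul_apply, Module.End.one_apply, map_sub, map_sub,
    incl_toNormal_act_L, Finsupp.sub_apply, mode_zero_apply _ _ (incl_mem _), map_smul, map_smul,
    Finsupp.smul_apply, ← algebraMap_smul (DualNumber ℂ) ((m : ℂ) + h), smul_eq_mul, ← sub_mul]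
  congr 1
  have hinl : (TrivSqZeroExt.inl h : DualNumber ℂ) = algebraMap ℂ (DualNumber ℂ) h := rfl
  rw [dualWeight, hinl]
  rw [Int.cast_add, Int.cast_natCast, map_add, map_add]
  ring

/-- The degree `n` subspace is spanned by the words of sum `-n`: on any other word,
`L 0 - n - h` acts by a unit of the dual numbers. -/
theorem sum_of_mem_degreeSpace {n : ℕ} {u : GenVerma c h 2} (hu : u ∈ degreeSpace c h 2 n)
    {w : List ℤ} (hw : w ∈ (incl (toNormal c h u)).support) : w.sum = -n := by
  by_contra hne
  rw [degreeSpace, LinearMap.mem_ker, sq, Module.End.mul_apply] at hu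
  have e := incl_toNormal_shifted c h n ((act c h 2 (L 0) -
      ((n : ℂ) + h) • (1 : Module.End ℂ (GenVerma c h 2))) u) w
  rw [hu, map_zero, map_zero, Finsupp.zero_apply, incl_toNormal_shifted] at e
  have hunit : IsUnit ((DualNumber.eps : DualNumber ℂ) -
      algebraMap ℂ (DualNumber ℂ) ((w.sum + n : ℤ) : ℂ)) := by
    rw [TrivSqZeroExt.isUnit_iff_isUnit_fst, isUnit_iff_ne_zero]
    have hz : ((w.sum + n : ℤ) : ℂ) ≠ 0 := by
      rw [Int.cast_ne_zero]
      omega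
    generalize ((w.sum + n : ℤ) : ℂ) = z at hz
    simpa [TrivSqZeroExt.algebraMap_eq_inl] using hz
  rw [eq_comm, hunit.mul_right_eq_zero, hunit.mul_right_eq_zero] at e
  exact Finsupp.mem_support_iff.1 hw e

/-- The coefficient of a vector at `L (-1) ^ n`, a dual number. -/
def leadingCoeff (n : ℕ) : GenVerma c h 2 →ₗ[ℂ] DualNumber ℂ :=
  Finsupp.lapply (List.replicate n (-1)) ∘ₗ incl ∘ₗ toNormal c h

theorem leadingCoeff_injective (n : ℕ) :
    Function.Injective (leadingCoeff c h n ∘ₗ (singularSpace c h 2 n).subtype) := by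
  rw [injective_iff_map_eq_zero]
  rintro ⟨u, hdeg, hsing⟩ hu
  have h0 : incl (toNormal c h u) = 0 := by
    refine eq_zero_of_singular c (dualWeight h) (n := n) (incl_mem _)
      (fun w hw => sum_of_mem_degreeSpace c h hdeg hw) (fun k hk => ?_) hu
    rw [← incl_toNormal_act_L, hsing k hk, map_zero, map_zero]
  have h1 : toNormal c h u = 0 := incl_injective (by rw [h0, map_zero])
  exact Subtype.ext (toNormal_injective c h (by rw [h1]; exact (map_zero _).symm))

end

end Virasoro

end

theorem mainTheorem10 (c h : ℂ) (n : ℕ) :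
    Module.rank ℂ (Virasoro.singularSpace c h 2 n) ≤ 2 := by
  refine (LinearMap.rank_le_of_injective _ (Virasoro.leadingCoeff_injective c h n)).trans ?_
  rw [← Virasoro.toDual.rank_eq]
  simp
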